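/- Let $a_1,\dots,a_n\in\mathbb{R}^d$ be points, possibly repeated or affinely dependent, that affinely span $\mathbb{R}^d$; put $v_i=(a_i,1)\in\mathbb{R}^{d+1}$ and $[0,v]=\{\alpha v:0\le\alpha\le1\}$. For $B\subseteq[n]$ let $\Delta_B=\mathrm{conv}\{a_b:b\in B\}$, for $Q\subseteq[n]$ let $\mathrm{conv}_Q(A)=\mathrm{conv}\{a_i:i\notin Q\}$, and for disjoint $I,B\subseteq[n]$ with $|B|=d+1$ and $(a_b)_{b\in B}$ affinely independent let $\Pi_{I,B}=\sum_{i\in I}v_i+\sum_{b\in B}[0,v_b]$, a tile of order $|I|$. A fine zonotopal tiling of $Z(V)=\sum_{i=1}^n[0,v_i]$ is a collection of tiles $\Pi_{I,B}$ (recorded by their labels $(I,B)$) that cover $Z(V)$ and any two of which meet in a common, possibly empty, face $\sum_{j\in J}v_j+\sum_{c\in C}[0,v_c]$ (where a face of $\Pi_{I,B}$ has $C\subseteq B$, $I\subseteq J\subseteq I\cup B$, $J\cap C=\varnothing$, with the same $(J,C)$ for both tiles). It is regular if its tiles are precisely the images, under the projection $\pi:\mathbb{R}^{d+2}\to\mathbb{R}^{d+1}$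 that deletes the $(d+1)$-th coordinate, of the $(d+1)$-dimensional faces of some zonotope in $\mathbb{R}^{d+2}$ that have an outward normal with positive $(d+1)$-th coordinate. Let $h=(h_1,\dots,h_n)$ be real heights that are generic: any $d+2$ of the lifted points $(a_i,h_i)\in\mathbb{R}^{d+1}$ that are affinely dependent lie on a vertical hyperplane (one whose normal has last coordinate $0$). For $Q\subseteq[n]$, a weighted Delaunay triangulation of a region $R$ for the points outside $Q$ is a triangulation of $R$ by nondegenerate simplices $\Delta_B$, $B\cap Q=\varnothing$, such that, with $B$ ordered so that $\det((a_b,1)_{b\in B})>0$, one has $\det((a_b,h_b,1)_{b\in B},(a_i,h_i,1))<0$ for every $i\notin Q\cup B$. Then for every $Q\subseteq[n]$ for which $\mathrm{conv}_Q(A)$ has nonempty interior there is exactly one weighted Delaunay triangulation $\mathcal{T}_Q(h)$ of $\mathrm{conv}_Q(A)$ for the points outside $Q$. Consider the following construction. Start with $\mathcal{I}^{(0)}=\{\varnothing\}$. For $k=0,1,\dots,n-d-1$ let $$\mathcal{P}^{(k)}=\{\Pi_{I,B}:I\in\mathcal{I}^{(k)},\ \Delta_B\in\mathcal{T}_I(h),\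 \Delta_B\subseteq\mathcal{R}(I)\},$$ $$\mathcal{I}^{(k+1)}=\{I\cup\{b\}:\Pi_{I,B}\in\mathcal{P}^{(k)},\ b\in B,\ \mathcal{R}(I\cup\{b\})\ne\varnothing\},$$ where the link region $\mathcal{R}(Q)$ is the closure of the interior of $\mathrm{conv}_Q(A)\setminus\bigcup_{r<|Q|}E^{(r)}(Q)$, and $E^{(r)}(Q)$ is the union of the $\Delta_B$ over the $\Pi_{I,B}\in\mathcal{P}^{(r)}$ with $B\cap Q=\varnothing$ and $I\subseteq Q$. This construction always succeeds: for every $0\le k\le n-d-1$ and $I\in\mathcal{I}^{(k)}$, the hull $\mathrm{conv}_I(A)$ has nonempty interior, $\mathcal{R}(I)\neq\varnothing$, and the simplices of $\mathcal{T}_I(h)$ contained in $\mathcal{R}(I)$ form a weighted Delaunay triangulation of $\mathcal{R}(I)$ for the points outside $I$; and $\mathcal{I}^{(n-d)}=\varnothing$. The result $\mathcal{P}(h)=\bigcup_{k=0}^{n-d-1}\mathcal{P}^{(k)}$ is a regular fine zonotopal tiling of $Z(V)$, its tiles of order $k$ are those in $\mathcal{P}^{(k)}$, and it is the projection of the lower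 hull of the lifted zonotope: with $\tilde v_i=(a_i,h_i,1)$, $Z(\tilde V)=\sum_i[0,\tilde v_i]$ and $\tilde\Pi_{I,B}=\sum_{i\in I}\tilde v_i+\sum_{b\in B}[0,\tilde v_b]$, the tile $\Pi_{I,B}$ belongs to $\mathcal{P}(h)$ if and only if $\tilde\Pi_{I,B}$ is a $(d+1)$-dimensional face of $Z(\tilde V)$ having an outward normal with negative $(d+1)$-th coordinate, and the tiles of $\mathcal{P}(h)$ are exactly the images under $\pi$ of all such faces of $Z(\tilde V)$. -/

import Mathlib

open scoped Pointwise

/-! Point configurations in `ℝ^d` are maps `a : Fin n → (Fin d → ℝ)`; repeated and affinely dependent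
points are allowed.  A height function assigns a height to every index, so repeated points may have
different heights. -/

/-- The projective lift `v_i = (a_i, 1)`. -/
def projLift {d n : ℕ} (a : Fin n → Fin d → ℝ) (i : Fin n) : Fin (d + 1) → ℝ :=
  Fin.snoc (α := fun _ => ℝ) (a i) 1

/-- The lifted point `(a_i, h_i)`. -/
def heightLift {d n : ℕ} (a : Fin n → Fin d → ℝ) (h : Fin n → ℝ) (i : Fin n) :
    Fin (d + 1) → ℝ :=
  Fin.snoc (α := fun _ => ℝ) (a i) (h i)

/-- The lifted vector `(a_i, h_i, 1)`, the projective lift of `(a_i, h_i)`. -/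
def fullLift {d n : ℕ} (a : Fin n → Fin d → ℝ) (h : Fin n → ℝ) : Fin n → Fin (d + 2) → ℝ :=
  projLift (heightLift a h)

/-- The height function is generic: any `d + 2` lifted points that are affinely dependent lie on a
vertical hyperplane, i.e. one whose normal has last coordinate zero. -/
def IsGenericHeight {d n : ℕ} (a : Fin n → Fin d → ℝ) (h : Fin n → ℝ) : Prop :=
  ∀ S : Finset (Fin n), S.card = d + 2 →
    ¬ AffineIndependent ℝ (fun i : S => heightLift a h i) →
    ∃ (N : Fin (d + 1) → ℝ) (c : ℝ), N ≠ 0 ∧ N (Fin.last d) = 0 ∧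
      ∀ i ∈ S, N ⬝ᵥ heightLift a h i = c

/-! ### Simplices and triangulations -/

/-- The convex hull `Δ_B` of the points with index in `B`. -/
def simplexOf {d n : ℕ} (a : Fin n → Fin d → ℝ) (B : Finset (Fin n)) : Set (Fin d → ℝ) :=
  convexHull ℝ (a '' (B : Set (Fin n)))

/-- `ch_Q(A)`, the convex hull of the points with index outside `Q`. -/
def hullOutside {d n : ℕ} (a : Fin n → Fin d → ℝ) (Q : Finset (Fin n)) : Set (Fin d → ℝ) :=
  convexHull ℝ (a '' {i | i ∉ Q})

/-- The index set `B` consists of the vertices of a nondegenerate `d`-simplex. -/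
def IsSimplexIndex {d n : ℕ} (a : Fin n → Fin d → ℝ) (B : Finset (Fin n)) : Prop :=
  B.card = d + 1 ∧ AffineIndependent ℝ (fun b : B => a b)

/-- A triangulation of the region `R` with vertices in the configuration.  The simplices are recorded
through the index sets of their vertices, one index set for each simplex.  Any two simplices meet
in a common, possibly empty, face; the faces of a simplex are the hulls of sets of its vertices. -/
structure IsTriangulation {d n : ℕ} (a : Fin n → Fin d → ℝ) (R : Set (Fin d → ℝ))
    (T : Set (Finset (Fin n))) : Prop where
  simplex : ∀ B ∈ T, IsSimplexIndex a B
  injOn : Set.InjOn (simplexOf a) T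
  cover : ⋃ B ∈ T, simplexOf a B = R
  inter : ∀ B ∈ T, ∀ B' ∈ T, ∃ C ⊆ B, ∃ C' ⊆ B',
    simplexOf a B ∩ simplexOf a B' = simplexOf a C ∧
    simplexOf a B ∩ simplexOf a B' = simplexOf a C'

/-- The weighted Delaunay condition for the simplex `B` among the points with index outside `Q`:
if `B` is ordered so that `det ((a_b, 1)_b) > 0`, then
`det ((a_b, h_b, 1)_b, (a_i, h_i, 1)) < 0` for all `i ∉ Q` that are not in `B`. -/
def DelaunayCondition {d n : ℕ} (a : Fin n → Fin d → ℝ) (h : Fin n → ℝ)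
    (Q B : Finset (Fin n)) : Prop :=
  ∃ e : Fin (d + 1) → Fin n, Finset.univ.image e = B ∧
    0 < Matrix.det (Matrix.of fun r => projLift a (e r)) ∧
    ∀ i, i ∉ Q → i ∉ B →
      Matrix.det (Matrix.of (Fin.snoc (α := fun _ => Fin (d + 2) → ℝ)
        (fun r => fullLift a h (e r)) (fullLift a h i))) < 0

/-- `T` is a weighted Delaunay triangulation, with height function `h`, of the region `R`, for the
subconfiguration of the points with index outside `Q`. -/
structure IsWeightedDelaunay {d n : ℕ} (a : Fin n → Fin d → ℝ) (h : Fin n → ℝ)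
    (Q : Finset (Fin n)) (R : Set (Fin d → ℝ)) (T : Set (Finset (Fin n))) : Prop where
  triangulation : IsTriangulation a R T
  outside : ∀ B ∈ T, Disjoint B Q
  delaunay : ∀ B ∈ T, DelaunayCondition a h Q B

/-! ### Zonotopes and their tilings -/

/-- The zonotope `∑ i, [0, w i]`. -/
def zonotope {m k : ℕ} (w : Fin m → Fin k → ℝ) : Set (Fin k → ℝ) :=
  ∑ i, segment ℝ 0 (w i)

/-- A pair `(I, B)` of index sets, the label of a tile `Π_{I,B}` or of a face of a tile. -/
abbrev TileLabel (n : ℕ) : Type := Finset (Fin n) × Finset (Fin n)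

/-- The parallelepiped `Π_{I,B} = ∑_{i ∈ I} w_i + ∑_{b ∈ B} [0, w_b]`. -/
def tileSet {n k : ℕ} (w : Fin n → Fin k → ℝ) (t : TileLabel n) : Set (Fin k → ℝ) :=
  {∑ i ∈ t.1, w i} + ∑ b ∈ t.2, segment ℝ 0 (w b)

/-- `Π_f` is a face of `Π_t`: it is obtained by fixing some of the coefficients of the segments
of `Π_t` to `0` or to `1`. -/
def IsTileFace {n : ℕ} (f t : TileLabel n) : Prop :=
  f.2 ⊆ t.2 ∧ t.1 ⊆ f.1 ∧ f.1 ⊆ t.1 ∪ t.2 ∧ Disjoint f.1 f.2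

/-- `P` is (the set of labels of) a fine zonotopal tiling of the zonotope of the projective lifts of
`a`: full-dimensional parallelepipeds that cover the zonotope, any two of which meet in a common,
possibly empty, face (with the same label in both, as is standard in the presence of repeated
vectors). -/
structure IsFineZonotopalTiling {d n : ℕ} (a : Fin n → Fin d → ℝ) (P : Set (TileLabel n)) :
    Prop where
  disjoint : ∀ t ∈ P, Disjoint t.1 t.2
  simplex : ∀ t ∈ P, IsSimplexIndex a t.2
  cover : ⋃ t ∈ P, tileSet (projLift a) t = zonotope (projLift a)
  inter : ∀ t ∈ P, ∀ t' ∈ P,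
    tileSet (projLift a) t ∩ tileSet (projLift a) t' = ∅ ∨
    ∃ f : TileLabel n, IsTileFace f t ∧ IsTileFace f t' ∧
      tileSet (projLift a) t ∩ tileSet (projLift a) t' = tileSet (projLift a) f

/-- The `(d+1)`-th of the `d + 2` coordinates. -/
def heightIndex (d : ℕ) : Fin (d + 2) := (Fin.last d).castSucc

/-- The projection `ℝ^(d+2) → ℝ^(d+1)` that removes the `(d+1)`-th coordinate. -/
def dropHeight {d : ℕ} (z : Fin (d + 2) → ℝ) : Fin (d + 1) → ℝ :=
  (heightIndex d).removeNth z

/-- The face of `Z` with outward normal `N`. -/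
def faceInDirection {k : ℕ} (Z : Set (Fin k → ℝ)) (N : Fin k → ℝ) : Set (Fin k → ℝ) :=
  {z ∈ Z | ∀ y ∈ Z, N ⬝ᵥ y ≤ N ⬝ᵥ z}

/-- `F` is a `(d+1)`-dimensional face of the upper hull of the polytope `Z ⊆ ℝ^(d+2)`: it has an
outward normal with positive `(d+1)`-th coordinate. -/
def IsUpperFacet {d : ℕ} (Z F : Set (Fin (d + 2) → ℝ)) : Prop :=
  (∃ N : Fin (d + 2) → ℝ, 0 < N (heightIndex d) ∧ F = faceInDirection Z N) ∧
    Module.finrank ℝ (vectorSpan ℝ F) = d + 1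

/-- `F` is a `(d+1)`-dimensional face of the lower hull of the polytope `Z ⊆ ℝ^(d+2)`: it has an
outward normal with negative `(d+1)`-th coordinate. -/
def IsLowerFacet {d : ℕ} (Z F : Set (Fin (d + 2) → ℝ)) : Prop :=
  (∃ N : Fin (d + 2) → ℝ, N (heightIndex d) < 0 ∧ F = faceInDirection Z N) ∧
    Module.finrank ℝ (vectorSpan ℝ F) = d + 1

/-- The tiles of `P` are precisely the projections of the upper facets of some zonotope
in `ℝ^(d+2)`. -/
def IsRegularTiling {d n : ℕ} (a : Fin n → Fin d → ℝ) (P : Set (TileLabel n)) : Prop :=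
  ∃ (m : ℕ) (w : Fin m → Fin (d + 2) → ℝ),
    tileSet (projLift a) '' P =
      {G | ∃ F, IsUpperFacet (zonotope w) F ∧ G = dropHeight '' F}

/-- The labels `(I, B)` for which the lifted parallelepiped `Π_{I,B}` is a lower facet of the
lifted zonotope. -/
def lowerHullLabels {d n : ℕ} (a : Fin n → Fin d → ℝ) (h : Fin n → ℝ) : Set (TileLabel n) :=
  {t | Disjoint t.1 t.2 ∧ t.2.card = d + 1 ∧
    IsLowerFacet (zonotope (fullLift a h)) (tileSet (fullLift a h) t)}

/-! ### The iterative construction -/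

/-- The region `E^(r)(Q)` computed from a set `P` of tiles: the union of the simplices `Δ_B` over the
tiles `(I, B)` of order `r` with `B ∩ Q = ∅` and `I ⊆ Q`. -/
def linkPart {d n : ℕ} (a : Fin n → Fin d → ℝ) (P : Set (TileLabel n)) (r : ℕ)
    (Q : Finset (Fin n)) : Set (Fin d → ℝ) :=
  ⋃ t ∈ {t : TileLabel n | t ∈ P ∧ t.1.card = r ∧ Disjoint t.2 Q ∧ t.1 ⊆ Q}, simplexOf a t.2

/-- The link region `R(Q)` computed from the tiles of order less than `|Q|`: the (regularized)
difference of `ch_Q(A)` and the regions `E^(r)(Q)` with `r < |Q|`.  The closure of the interior is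
taken because link regions are unions of closed `d`-simplices: this keeps the boundary, and it makes
the region empty if the difference has no interior. -/
def linkRegion {d n : ℕ} (a : Fin n → Fin d → ℝ) (P : Set (TileLabel n))
    (Q : Finset (Fin n)) : Set (Fin d → ℝ) :=
  closure (interior (hullOutside a Q \ ⋃ r ∈ Finset.range Q.card, linkPart a P r Q))

/-- The simplices of `T Q` that lie in the link region of `Q`. -/
def linkSimplices {d n : ℕ} (a : Fin n → Fin d → ℝ) (T : Finset (Fin n) → Set (Finset (Fin n)))
    (P : Set (TileLabel n)) (Q : Finset (Fin n)) : Set (Finset (Fin n)) :=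
  {B ∈ T Q | simplexOf a B ⊆ linkRegion a P Q}

/-- The tiles `(I, B)` with `I` in the given family and `B` a simplex of `T I` in the link
region of `I`. -/
def newTiles {d n : ℕ} (a : Fin n → Fin d → ℝ) (T : Finset (Fin n) → Set (Finset (Fin n)))
    (𝓘 : Set (Finset (Fin n))) (P : Set (TileLabel n)) : Set (TileLabel n) :=
  {t | t.1 ∈ 𝓘 ∧ t.2 ∈ linkSimplices a T P t.1}

/-- The state of the construction before step `k`: the family `𝓘^(k)`, and the set of all the tiles
obtained so far, i.e. those of the steps `0, …, k - 1`. -/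
def constructionState {d n : ℕ} (a : Fin n → Fin d → ℝ)
    (T : Finset (Fin n) → Set (Finset (Fin n))) :
    ℕ → Set (Finset (Fin n)) × Set (TileLabel n)
  | 0 => ({∅}, ∅)
  | k + 1 =>
    let S := constructionState a T k
    let new := newTiles a T S.1 S.2
    ({J | ∃ t ∈ new, ∃ b ∈ t.2, J = insert b t.1 ∧ (linkRegion a (S.2 ∪ new) J).Nonempty},
      S.2 ∪ new)

/-- The family `𝓘^(k)`. -/
def indexFamily {d n : ℕ} (a : Fin n → Fin d → ℝ) (T : Finset (Fin n) → Set (Finset (Fin n)))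
    (k : ℕ) : Set (Finset (Fin n)) :=
  (constructionState a T k).1

/-- The tiles obtained in the steps `0, …, k - 1`. -/
def tilesBefore {d n : ℕ} (a : Fin n → Fin d → ℝ) (T : Finset (Fin n) → Set (Finset (Fin n)))
    (k : ℕ) : Set (TileLabel n) :=
  (constructionState a T k).2

/-- The tiles `𝒫^(k)` obtained in step `k`. -/
def tilesAt {d n : ℕ} (a : Fin n → Fin d → ℝ) (T : Finset (Fin n) → Set (Finset (Fin n)))
    (k : ℕ) : Set (TileLabel n) :=
  newTiles a T (indexFamily a T k) (tilesBefore a T k)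

/-- The result of the construction: the union of the `𝒫^(k)` with `0 ≤ k ≤ n - d - 1`. -/
def constructedTiles {d n : ℕ} (a : Fin n → Fin d → ℝ)
    (T : Finset (Fin n) → Set (Finset (Fin n))) : Set (TileLabel n) :=
  ⋃ k ∈ {k : ℕ | k + d + 1 ≤ n}, tilesAt a T k

/-
A vector `v_i` and its height define the hyperplane `φ (v_i) = h_i` in the space of the linear
functionals `φ` on `ℝ^(d+1)`.  Genericity makes this arrangement simple: the hyperplanes through a
vertex `φ` form a basis `B`.  Let `I` be the set of all `i` with `φ (v_i) > h_i`.  The outward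
normals of the lower facets of the lifted zonotope are, up to scaling, `(φ, -1)` for the vertices
`φ`, and the facet belonging to `φ` lies above the tile `Π_{I,B}`.  For `B` positively ordered, the
determinant in the Delaunay condition has the sign of `φ (v_i) - h_i`, so the weighted Delaunay
simplices of the points outside `Q` are the `Δ_B` with `B ∩ Q = ∅` and `I ⊆ Q`.

Both the zonotope and the hulls are covered because a vertex that minimizes the piecewise linear
convex function of the dual linear program is also minimal along the edges that leave it.  Among
the simplices for `Q`, those with `I ≠ Q` come from tiles of smaller order, so the link region of
`Q` is the union of the `Δ_B` with `I = Q`.  The construction meets every vertex: of the vertices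
with a given `I ≠ ∅`, the one with the least value at some `v_i` with `i ∈ I` has an edge that
decreases this value, and the edge ends at a vertex whose set is `I` without one element.
-/

/-! ### Exchanging vectors of a basis -/

section Exchange

variable {𝕜 E ι : Type*} [Field 𝕜] [AddCommGroup E] [Module 𝕜 E] {v : ι → E} {g : Module.Dual 𝕜 E}

lemma exists_dual_eq_on {s : Set ι} (hs : LinearIndepOn 𝕜 v s) (f : ι → 𝕜) :
    ∃ φ : Module.Dual 𝕜 E, ∀ i ∈ s, φ (v i) = f i := by
  obtain ⟨φ, hφ⟩ := (Module.Basis.constr (Module.Basis.span hs) 𝕜 fun i : s => f i).exists_extend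
  refine ⟨φ, fun i hi => ?_⟩
  have hvi : (Module.Basis.span hs ⟨i, hi⟩ : E) = v i :=
    congrArg Subtype.val (Module.Basis.span_apply hs _)
  simpa [hvi] using LinearMap.congr_fun hφ (Module.Basis.span hs ⟨i, hi⟩)

lemma exists_dual_eq_single [DecidableEq ι] {B : Finset ι}
    (hB : LinearIndepOn 𝕜 v (B : Set ι)) {b : ι} (hb : b ∈ B) (r : 𝕜) :
    ∃ g : Module.Dual 𝕜 E, g (v b) = r ∧ ∀ c ∈ B.erase b, g (v c) = 0 := by
  obtain ⟨g, hg⟩ := exists_dual_eq_on hB (Pi.single b r)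
  refine ⟨g, by simpa using hg b hb, fun c hc => ?_⟩
  rw [hg c (Finset.mem_of_mem_erase hc), Pi.single_eq_of_ne (Finset.ne_of_mem_erase hc)]

lemma span_insert_erase_eq_top [DecidableEq ι] {B : Finset ι} {b i : ι}
    (hB : Submodule.span 𝕜 (v '' B) = ⊤) (hg : ∀ c ∈ B.erase b, g (v c) = 0) (hi : g (v i) ≠ 0) :
    Submodule.span 𝕜 (v '' insert i (B.erase b) : Set E) = ⊤ := by
  have hker : Submodule.span 𝕜 (v '' (B.erase b : Finset ι)) ≤ LinearMap.ker g := by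
    rw [Submodule.span_le]
    rintro _ ⟨c, hc, rfl⟩
    exact hg c hc
  have hBb : v '' B ⊆ insert (v b) (v '' (B.erase b : Finset ι)) := by
    rw [← Set.image_insert_eq]
    refine Set.image_mono fun c hc => ?_
    by_cases hcb : c = b <;> simp_all
  have hvb : v b ∈ Submodule.span 𝕜 (insert (v i) (v '' (B.erase b : Finset ι))) := by
    refine mem_span_insert_exchange (Submodule.span_mono hBb ?_) fun hmem => hi (hker hmem)
    rw [hB]
    trivial
  rw [Set.image_insert_eq, ← top_le_iff, ← hB, Submodule.span_le]
  exact hBb.trans (Set.insert_subset hvb ((Set.subset_insert _ _).trans Submodule.subset_span))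

end Exchange

/-! ### Signs -/

section Signs

variable {𝕜 ι : Type*} [Field 𝕜] [LinearOrder 𝕜] [IsStrictOrderedRing 𝕜]

/- The sign of `x i` is kept as long as `1 + s * (y i / x i)` is nonnegative, so the first sign
change occurs at the index with the least quotient `y i / x i`. -/
lemma exists_first_sign_change (S : Finset ι) (x y : ι → 𝕜) :
    (∀ s, 0 ≤ s → ∀ k ∈ S, 0 ≤ x k * (x k + s * y k)) ∨
      ∃ s, 0 < s ∧ (∃ i ∈ S, x i ≠ 0 ∧ x i + s * y i = 0) ∧
        ∀ k ∈ S, 0 ≤ x k * (x k + s * y k) := by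
  have hfactor (s : 𝕜) (k : ι) (hk : 0 ≤ 1 + s * (y k / x k)) : 0 ≤ x k * (x k + s * y k) := by
    rcases eq_or_ne (x k) 0 with h0 | h0
    · simp [h0]
    · have : x k * (x k + s * y k) = x k ^ 2 * (1 + s * (y k / x k)) := by field_simp
      rw [this]
      positivity
  by_cases hneg : ∃ i ∈ S, y i / x i < 0
  · right
    obtain ⟨j, hjS, hj⟩ := hneg
    obtain ⟨i, hiS, hmin⟩ := S.exists_min_image (fun k => y k / x k) ⟨j, hjS⟩
    have hi : y i / x i < 0 := (hmin j hjS).trans_lt hj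
    have hx : x i ≠ 0 := fun h0 => by simp [h0] at hi
    have hy : y i ≠ 0 := fun h0 => by simp [h0] at hi
    refine ⟨-(y i / x i)⁻¹, neg_pos.2 (inv_lt_zero.2 hi), ⟨i, hiS, hx, by field_simp; ring⟩,
      fun k hk => hfactor _ k ?_⟩
    have hmul := mul_le_mul_of_nonneg_left (hmin k hk) (a := -(y i / x i)⁻¹)
      (neg_nonneg.2 (inv_nonpos.2 hi.le))
    rw [neg_mul, inv_mul_cancel₀ hi.ne] at hmul
    linarith
  · left
    push Not at hneg
    exact fun s hs k hk => hfactor s k (by have := mul_nonneg hs (hneg k hk); linarith)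

lemma mul_le_max_zero {a : 𝕜} (ha : a ∈ Set.Icc 0 1) (x : 𝕜) : a * x ≤ max 0 x :=
  (mul_le_mul_of_nonneg_left (le_max_right 0 x) ha.1).trans
    (mul_le_of_le_one_left (le_max_left 0 x) ha.2)

lemma exists_nonneg_add_mul_lt {y : 𝕜} (hy : y < 0) (x c : 𝕜) :
    ∃ s, 0 ≤ s ∧ x + s * y < c := by
  refine ⟨(|x - c| + 1) / -y, div_nonneg (by positivity) (by linarith), ?_⟩
  have hmul : (|x - c| + 1) / -y * y = -(|x - c| + 1) := by
    rw [div_neg, neg_mul, div_mul_cancel₀ _ hy.ne]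
  linarith [le_abs_self (x - c)]

end Signs

/-! ### Vertices of an arrangement of hyperplanes -/

section Arrangement

variable {𝕜 E ι : Type*} [Field 𝕜] [AddCommGroup E] [Module 𝕜 E] {v : ι → E} {h : ι → 𝕜}
  {φ ψ g : Module.Dual 𝕜 E}

/-- The amount by which the functional `φ` exceeds the height `h i` at the vector `v i`.  The
equations `excess v h φ i = 0` define an affine arrangement of hyperplanes in the dual space. -/
def excess (v : ι → E) (h : ι → 𝕜) (φ : Module.Dual 𝕜 E) (i : ι) : 𝕜 := φ (v i) - h i

lemma excess_add_smul (s : 𝕜) (i : ι) :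
    excess v h (φ + s • g) i = excess v h φ i + s * g (v i) := by
  simp only [excess, LinearMap.add_apply, LinearMap.smul_apply, smul_eq_mul]
  ring

lemma sum_mul_excess (S : Finset ι) (α : ι → 𝕜) :
    ∑ i ∈ S, α i * excess v h φ i = φ (∑ i ∈ S, α i • v i) - ∑ i ∈ S, α i * h i := by
  simp only [excess, map_sum, map_smul, smul_eq_mul, mul_sub, Finset.sum_sub_distrib]

variable [LinearOrder 𝕜] [Fintype ι]

/-- The hyperplanes of the arrangement that pass through `φ`. -/
def tightSet (v : ι → E) (h : ι → 𝕜) (φ : Module.Dual 𝕜 E) : Finset ι := {i | excess v h φ i = 0}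

/-- The hyperplanes of the arrangement that have `φ` on their positive side. -/
def aboveSet (v : ι → E) (h : ι → 𝕜) (φ : Module.Dual 𝕜 E) : Finset ι := {i | 0 < excess v h φ i}

/-- `φ` is a vertex of the arrangement: the hyperplanes through `φ` have no other common point. -/
def IsVertex (v : ι → E) (h : ι → 𝕜) (φ : Module.Dual 𝕜 E) : Prop :=
  Submodule.span 𝕜 (v '' tightSet v h φ) = ⊤

/-- The arrangement is simple: the hyperplanes through a vertex are in general position. -/
def IsGeneric (v : ι → E) (h : ι → 𝕜) : Prop :=
  ∀ φ, IsVertex v h φ → LinearIndepOn 𝕜 v (tightSet v h φ : Set ι)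

/-- The labels `(I, B)` of the vertices of the arrangement: `B` consists of the hyperplanes through
the vertex and `I` of those that have it on their positive side. -/
def vertexTiles (v : ι → E) (h : ι → 𝕜) : Set (Finset ι × Finset ι) :=
  {t | ∃ φ, IsVertex v h φ ∧ t = (aboveSet v h φ, tightSet v h φ)}

@[simp]
lemma mem_tightSet {i : ι} : i ∈ tightSet v h φ ↔ excess v h φ i = 0 := by simp [tightSet]

@[simp]
lemma mem_aboveSet {i : ι} : i ∈ aboveSet v h φ ↔ 0 < excess v h φ i := by simp [aboveSet]

lemma tightSet_smul {σ : 𝕜} (hσ : σ ≠ 0) : tightSet v (σ • h) (σ • φ) = tightSet v h φ := by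
  ext i
  have hexcess : excess v (σ • h) (σ • φ) i = σ * excess v h φ i := (mul_sub σ _ _).symm
  rw [mem_tightSet, mem_tightSet, hexcess, mul_eq_zero, or_iff_right hσ]

lemma excess_nonpos_of_notMem {Q : Finset ι} (hQ : aboveSet v h φ ⊆ Q) {i : ι} (hi : i ∉ Q) :
    excess v h φ i ≤ 0 :=
  not_lt.1 fun hpos => hi (hQ (mem_aboveSet.2 hpos))

lemma sum_tightSet_mul_excess (α : ι → 𝕜) :
    ∑ i ∈ tightSet v h φ, α i * excess v h ψ i =
      ψ (∑ i ∈ tightSet v h φ, α i • v i) - φ (∑ i ∈ tightSet v h φ, α i • v i) := by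
  have hzero : ∑ i ∈ tightSet v h φ, α i * excess v h φ i = 0 :=
    Finset.sum_eq_zero fun i hi => by rw [mem_tightSet.1 hi, mul_zero]
  rw [sum_mul_excess] at hzero
  rw [sum_mul_excess, sub_eq_zero.1 hzero]

lemma IsVertex.eq_of_tightSet_subset (hφ : IsVertex v h φ)
    (hψ : tightSet v h φ ⊆ tightSet v h ψ) : φ = ψ := by
  refine LinearMap.ext_on hφ ?_
  rintro _ ⟨i, hi, rfl⟩
  rw [sub_eq_zero.1 (mem_tightSet.1 hi), sub_eq_zero.1 (mem_tightSet.1 (hψ hi))]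

lemma eq_of_mem_vertexTiles {I I' B : Finset ι} (hI : (I, B) ∈ vertexTiles v h)
    (hI' : (I', B) ∈ vertexTiles v h) : I = I' := by
  obtain ⟨φ, hφ, heq⟩ := hI
  obtain ⟨φ', -, heq'⟩ := hI'
  obtain ⟨rfl, rfl⟩ := Prod.mk.inj heq
  obtain ⟨rfl, htight⟩ := Prod.mk.inj heq'
  rw [hφ.eq_of_tightSet_subset htight.subset]

lemma finite_setOf_isVertex (v : ι → E) (h : ι → 𝕜) : {φ | IsVertex v h φ}.Finite :=
  Set.Finite.of_finite_image (f := tightSet v h) (Set.toFinite _)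
    fun _ hφ _ _ heq => IsVertex.eq_of_tightSet_subset hφ heq.subset

lemma IsGeneric.tightSet_eq (hgen : IsGeneric v h) {B : Finset ι}
    (hB : Submodule.span 𝕜 (v '' B) = ⊤) (hBφ : B ⊆ tightSet v h φ) : tightSet v h φ = B := by
  have hφ : IsVertex v h φ :=
    top_unique (hB.ge.trans (Submodule.span_mono (Set.image_mono (mod_cast hBφ))))
  refine subset_antisymm (fun i hi => by_contra fun hiB => ?_) hBφ
  have hli : LinearIndepOn 𝕜 v (insert i (B : Set ι)) :=
    (hgen φ hφ).mono (Set.insert_subset hi (mod_cast hBφ))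
  exact hli.notMem_span_of_insert (mod_cast hiB) (hB ▸ Submodule.mem_top)

lemma IsGeneric.exists_tightSet_eq (hgen : IsGeneric v h) {B : Finset ι}
    (hB : LinearIndepOn 𝕜 v (B : Set ι)) (hspan : Submodule.span 𝕜 (v '' B) = ⊤) :
    ∃ φ, IsVertex v h φ ∧ tightSet v h φ = B := by
  obtain ⟨φ, hφ⟩ := exists_dual_eq_on hB h
  have htight := hgen.tightSet_eq hspan fun b hb => mem_tightSet.2 (sub_eq_zero.2 (hφ b hb))
  exact ⟨φ, by rwa [IsVertex, htight], htight⟩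

lemma IsGeneric.exists_isVertex (hgen : IsGeneric v h) {S : Finset ι}
    (hS : Submodule.span 𝕜 (v '' S) = ⊤) : ∃ φ, IsVertex v h φ ∧ tightSet v h φ ⊆ S := by
  obtain ⟨B, hBS, -, hSB, hB⟩ := exists_linearIndepOn_extension (linearIndepOn_empty 𝕜 v)
    (Set.empty_subset (S : Set ι))
  lift B to Finset ι using B.toFinite
  obtain ⟨φ, hφ, htight⟩ :=
    hgen.exists_tightSet_eq hB (top_unique (hS.ge.trans (Submodule.span_le.2 hSB)))
  exact ⟨φ, hφ, htight.trans_subset (mod_cast hBS)⟩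

variable [IsStrictOrderedRing 𝕜] [DecidableEq ι]

lemma IsGeneric.exists_pivot (hgen : IsGeneric v h) (hφ : IsVertex v h φ) {b : ι}
    (hg : ∀ c ∈ (tightSet v h φ).erase b, g (v c) = 0) (S : Finset ι) :
    (∀ s : 𝕜, 0 ≤ s → ∀ k ∈ S, 0 ≤ excess v h φ k * excess v h (φ + s • g) k) ∨
      ∃ s : 𝕜, 0 < s ∧ IsVertex v h (φ + s • g) ∧
        (∃ i ∈ S, tightSet v h (φ + s • g) = insert i ((tightSet v h φ).erase b)) ∧
        ∀ k ∈ S, 0 ≤ excess v h φ k * excess v h (φ + s • g) k := by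
  have hfirst := exists_first_sign_change S (excess v h φ) fun k => g (v k)
  simp only [← excess_add_smul] at hfirst
  refine hfirst.imp_right ?_
  rintro ⟨s, hs, ⟨i, hiS, hi, hzero⟩, hside⟩
  have hspan := span_insert_erase_eq_top (i := i) hφ hg fun h0 =>
    hi (by simpa [excess_add_smul, h0] using hzero)
  rw [← Finset.coe_insert] at hspan
  have htight : tightSet v h (φ + s • g) = insert i ((tightSet v h φ).erase b) := by
    refine hgen.tightSet_eq hspan fun k hk => ?_
    rw [mem_tightSet]
    rcases Finset.mem_insert.1 hk with rfl | hk
    · exact hzero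
    · rw [excess_add_smul, hg k hk, mem_tightSet.1 (Finset.mem_of_mem_erase hk), mul_zero, add_zero]
  exact ⟨s, hs, by rwa [IsVertex, htight], ⟨i, hiS, htight⟩, hside⟩

lemma aboveSet_eq_erase {i : ι} (hi : i ∈ tightSet v h ψ)
    (htight : tightSet v h ψ ⊆ insert i (tightSet v h φ))
    (hle : ∀ c ∈ tightSet v h φ, excess v h ψ c ≤ 0)
    (hside : ∀ k, 0 ≤ excess v h φ k * excess v h ψ k) :
    aboveSet v h ψ = (aboveSet v h φ).erase i := by
  ext k
  rw [Finset.mem_erase, mem_aboveSet, mem_aboveSet]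
  rcases eq_or_ne k i with rfl | hki
  · simp [mem_tightSet.1 hi]
  by_cases hk : k ∈ tightSet v h φ
  · simp [mem_tightSet.1 hk, hle k hk]
  · have hkψ : k ∉ tightSet v h ψ := fun hmem => (Finset.mem_insert.1 (htight hmem)).elim hki hk
    have hpos : 0 < excess v h φ k * excess v h ψ k :=
      (hside k).lt_of_ne' (mul_ne_zero (by simpa using hk) (by simpa using hkψ))
    simp [hki, pos_iff_pos_of_mul_pos hpos]

lemma IsGeneric.exists_descending_edge (hgen : IsGeneric v h) (hφ : IsVertex v h φ)
    {u : Module.Dual 𝕜 E} (hu : ∀ i, 0 ≤ u (v i)) {z : E} (hz : 0 < u z) :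
    ∃ b ∈ tightSet v h φ, ∃ g : Module.Dual 𝕜 E, g (v b) = -1 ∧
      (∀ c ∈ (tightSet v h φ).erase b, g (v c) = 0) ∧ g z < 0 := by
  obtain ⟨c, hc⟩ := (Submodule.mem_span_image_finset_iff_exists_fun' 𝕜).1
    (hφ.ge (Submodule.mem_top (x := z)))
  obtain ⟨b, hb, hcb⟩ : ∃ b ∈ tightSet v h φ, 0 < c b := by
    by_contra! hneg
    have hle : u z ≤ 0 := by
      rw [← hc, map_sum]
      refine Finset.sum_nonpos fun b hb => ?_
      rw [map_smul, smul_eq_mul]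
      exact mul_nonpos_of_nonpos_of_nonneg (hneg b hb) (hu b)
    exact hz.not_ge hle
  obtain ⟨g, hgb, hg⟩ := exists_dual_eq_single (hgen φ hφ) hb (-1)
  have hgz : g z < 0 := by
    rw [← hc, map_sum, ← Finset.add_sum_erase _ _ hb,
      Finset.sum_eq_zero fun k hk => by rw [map_smul, hg k hk, smul_zero], map_smul, hgb]
    simpa using hcb
  exact ⟨b, hb, g, hgb, hg, hgz⟩

/- Among the vertices with positive set `J`, take the one that is lowest at some `v j₀` with
`j₀ ∈ J`, and leave it along an edge that decreases the value there. -/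
lemma IsGeneric.exists_lower_vertexTile (hgen : IsGeneric v h) {u : Module.Dual 𝕜 E}
    (hu : ∀ i, 0 < u (v i)) {J B : Finset ι} (hJB : (J, B) ∈ vertexTiles v h) (hJ : J.Nonempty) :
    ∃ t ∈ vertexTiles v h, ∃ j ∈ t.2, j ∉ t.1 ∧ J = insert j t.1 := by
  obtain ⟨j₀, hj₀⟩ := hJ
  obtain ⟨φ₀, hφ₀, heq₀⟩ := hJB
  obtain ⟨φ, ⟨hφ, hφJ⟩, hmin⟩ := Set.exists_min_image
    {φ | IsVertex v h φ ∧ aboveSet v h φ = J} (fun φ => φ (v j₀))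
    ((finite_setOf_isVertex v h).subset fun _ hφ => hφ.1) ⟨φ₀, hφ₀, (congrArg Prod.fst heq₀).symm⟩
  obtain ⟨b, -, g, hgb, hg, hgj₀⟩ :=
    hgen.exists_descending_edge hφ (fun i => (hu i).le) (hu j₀)
  rcases hgen.exists_pivot hφ hg Finset.univ with hall | ⟨s, hs, hvert, ⟨i, -, htight⟩, hside⟩
  · obtain ⟨s, hs, hlt⟩ := exists_nonneg_add_mul_lt hgj₀ (excess v h φ j₀) 0
    have hmul := hall s hs j₀ (Finset.mem_univ _)
    rw [excess_add_smul] at hmul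
    exact absurd hmul (mul_neg_of_pos_of_neg (mem_aboveSet.1 (hφJ ▸ hj₀)) hlt).not_ge
  · have hi : i ∈ tightSet v h (φ + s • g) := htight ▸ Finset.mem_insert_self _ _
    have habove : aboveSet v h (φ + s • g) = J.erase i := by
      rw [← hφJ]
      refine aboveSet_eq_erase hi ?_ (fun c hc => ?_) fun k => hside k (Finset.mem_univ _)
      · exact htight ▸ Finset.insert_subset_insert _ (Finset.erase_subset _ _)
      · rw [excess_add_smul, mem_tightSet.1 hc, zero_add]
        refine mul_nonpos_of_nonneg_of_nonpos hs.le ?_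
        rcases eq_or_ne c b with rfl | hcb
        · simp [hgb]
        · exact (hg c (Finset.mem_erase.2 ⟨hcb, hc⟩)).le
    have hiJ : i ∈ J := by
      by_contra hiJ
      have hle := hmin (φ + s • g) ⟨hvert, by rw [habove, Finset.erase_eq_of_notMem hiJ]⟩
      rw [LinearMap.add_apply, LinearMap.smul_apply, smul_eq_mul] at hle
      linarith [mul_neg_of_pos_of_neg hs hgj₀]
    exact ⟨_, ⟨_, hvert, rfl⟩, i, hi, by simp [habove],
      by rw [habove, Finset.insert_erase hiJ]⟩

end Arrangement

/-! ### The zonotope of a vector configuration is covered by the tiles of the vertices -/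

section Cover

variable {𝕜 E ι : Type*} [Field 𝕜] [LinearOrder 𝕜] [AddCommGroup E] [Module 𝕜 E]

/-- The dual objective of the linear program that minimizes the height `∑ i ∈ S, α i * h i` over the
representations `z = ∑ i ∈ S, α i • v i` with coefficients in `[0, 1]`. -/
def dualObjective (v : ι → E) (h : ι → 𝕜) (S : Finset ι) (z : E) (φ : Module.Dual 𝕜 E) : 𝕜 :=
  ∑ i ∈ S, max 0 (excess v h φ i) - φ z

variable [IsStrictOrderedRing 𝕜] {v : ι → E} {h : ι → 𝕜} {S : Finset ι} {z : E}
  {φ ψ : Module.Dual 𝕜 E}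

lemma neg_sum_le_dualObjective {α : ι → 𝕜} (hα : ∀ i ∈ S, α i ∈ Set.Icc 0 1)
    (hz : ∑ i ∈ S, α i • v i = z) : -∑ i ∈ S, α i * h i ≤ dualObjective v h S z φ := by
  have hle := Finset.sum_le_sum fun i hi => mul_le_max_zero (hα i hi) (excess v h φ i)
  rw [sum_mul_excess, hz] at hle
  rw [dualObjective]
  linarith

variable [Fintype ι] [DecidableEq ι]

lemma sum_max_excess_eq (hS : tightSet v h φ ⊆ S)
    (hside : ∀ i ∈ S, 0 ≤ excess v h φ i * excess v h ψ i) :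
    ∑ i ∈ S, max 0 (excess v h ψ i) = ∑ i ∈ aboveSet v h φ ∩ S, excess v h ψ i +
      ∑ i ∈ tightSet v h φ, max 0 (excess v h ψ i) := by
  rw [Finset.inter_comm, ← Finset.sum_ite_mem, ← Finset.inter_eq_right.2 hS, ← Finset.sum_ite_mem,
    ← Finset.sum_add_distrib]
  refine Finset.sum_congr rfl fun i hi => ?_
  simp only [mem_aboveSet, mem_tightSet]
  have hi' := hside i hi
  rcases lt_trichotomy (excess v h φ i) 0 with hneg | hzero | hpos
  · simp [hneg.not_gt, hneg.ne, nonpos_of_mul_nonneg_right hi' hneg]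
  · simp [hzero]
  · simp [hpos, hpos.ne', nonneg_of_mul_nonneg_right hi' hpos]

lemma dualObjective_sub {β : ι → 𝕜} (hS : tightSet v h φ ⊆ S)
    (hside : ∀ i ∈ S, 0 ≤ excess v h φ i * excess v h ψ i)
    (hz : z = ∑ i ∈ aboveSet v h φ ∩ S, v i + ∑ b ∈ tightSet v h φ, β b • v b) :
    dualObjective v h S z ψ - dualObjective v h S z φ =
      ∑ b ∈ tightSet v h φ, (max 0 (excess v h ψ b) - β b * excess v h ψ b) := by
  have hvalue (θ : Module.Dual 𝕜 E) (hθ : ∀ i ∈ S, 0 ≤ excess v h φ i * excess v h θ i) :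
      dualObjective v h S z θ =
        ∑ b ∈ tightSet v h φ, (max 0 (excess v h θ b) - β b * excess v h θ b) -
          ∑ i ∈ aboveSet v h φ ∩ S, h i - ∑ b ∈ tightSet v h φ, β b * h b := by
    rw [dualObjective, sum_max_excess_eq hS hθ, hz]
    simp only [excess, map_add, map_sum, map_smul, smul_eq_mul, mul_sub, Finset.sum_sub_distrib]
    ring
  have hzero : ∑ b ∈ tightSet v h φ, (max 0 (excess v h φ b) - β b * excess v h φ b) = 0 :=
    Finset.sum_eq_zero fun b hb => by simp [mem_tightSet.1 hb]
  rw [hvalue ψ hside, hvalue φ fun i _ => mul_self_nonneg _, hzero]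
  ring

/- At a vertex that minimizes the dual objective the coefficients lie in `[0, 1]`: otherwise some
edge from the vertex decreases the objective, which weak duality bounds from below. -/
lemma IsGeneric.exists_vertex_sum_eq (hgen : IsGeneric v h)
    (hS : Submodule.span 𝕜 (v '' S) = ⊤) {α : ι → 𝕜} (hα : ∀ i ∈ S, α i ∈ Set.Icc 0 1)
    (hz : ∑ i ∈ S, α i • v i = z) :
    ∃ φ, IsVertex v h φ ∧ tightSet v h φ ⊆ S ∧ ∃ β : ι → 𝕜,
      (∀ b ∈ tightSet v h φ, β b ∈ Set.Icc 0 1) ∧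
        z = ∑ i ∈ aboveSet v h φ ∩ S, v i + ∑ b ∈ tightSet v h φ, β b • v b := by
  obtain ⟨φ, ⟨hφ, hφS⟩, hmin⟩ := Set.exists_min_image
    {φ | IsVertex v h φ ∧ tightSet v h φ ⊆ S} (dualObjective v h S z)
    ((finite_setOf_isVertex v h).subset fun _ hφ => hφ.1) (hgen.exists_isVertex hS)
  obtain ⟨β, hβ⟩ := (Submodule.mem_span_image_finset_iff_exists_fun' 𝕜).1
    (hφ.ge (Submodule.mem_top (x := z - ∑ i ∈ aboveSet v h φ ∩ S, v i)))
  have hzβ : z = ∑ i ∈ aboveSet v h φ ∩ S, v i + ∑ b ∈ tightSet v h φ, β b • v b := by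
    rw [hβ, add_sub_cancel]
  refine ⟨φ, hφ, hφS, β, fun b hb => by_contra fun hbad => ?_, hzβ⟩
  obtain ⟨r, hr⟩ : ∃ r : 𝕜, max 0 r - β b * r < 0 := by
    rw [Set.mem_Icc, not_and_or, not_le, not_le] at hbad
    rcases hbad with hbad | hbad
    · exact ⟨-1, by simpa using hbad⟩
    · exact ⟨1, by simpa using hbad⟩
  obtain ⟨g, hgb, hg⟩ := exists_dual_eq_single (hgen φ hφ) hb r
  have hedge (s : 𝕜) (hs : 0 ≤ s)
      (hside : ∀ i ∈ S, 0 ≤ excess v h φ i * excess v h (φ + s • g) i) :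
      dualObjective v h S z (φ + s • g) =
        dualObjective v h S z φ + s * (max 0 r - β b * r) := by
    rw [← sub_eq_iff_eq_add', dualObjective_sub hφS hside hzβ, Finset.sum_eq_single_of_mem b hb]
    · rw [excess_add_smul, mem_tightSet.1 hb, hgb, mul_sub, mul_max_of_nonneg _ _ hs]
      ring_nf
    · intro c hc hcb
      simp [excess_add_smul, mem_tightSet.1 hc, hg c (Finset.mem_erase.2 ⟨hcb, hc⟩)]
  rcases hgen.exists_pivot hφ hg S with hall | ⟨s, hs, hvert, ⟨i, hi, htight⟩, hside⟩
  · obtain ⟨s, hs, hlt⟩ :=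
      exists_nonneg_add_mul_lt hr (dualObjective v h S z φ) (-∑ i ∈ S, α i * h i)
    rw [← hedge s hs (hall s hs)] at hlt
    exact (neg_sum_le_dualObjective hα hz).not_gt hlt
  · have hle := hmin (φ + s • g) ⟨hvert, htight ▸
      Finset.insert_subset hi ((Finset.erase_subset _ _).trans hφS)⟩
    rw [hedge s hs.le hside] at hle
    linarith [mul_neg_of_pos_of_neg hs hr]

end Cover

/-! ### Tiles and faces of zonotopes -/

section Tiles

variable {n k : ℕ} {u : Fin n → Fin k → ℝ} {t t' f : TileLabel n} {x α : Fin n → ℝ}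
  {z : Fin k → ℝ}

lemma mem_sum_segment_iff {S : Finset (Fin n)} :
    z ∈ ∑ i ∈ S, segment ℝ 0 (u i) ↔
      ∃ α : Fin n → ℝ, (∀ i ∈ S, α i ∈ Set.Icc 0 1) ∧ ∑ i ∈ S, α i • u i = z := by
  simp only [Set.mem_finsetSum, segment_eq_image, smul_zero, zero_add]
  constructor
  · rintro ⟨g, hg, rfl⟩
    choose! α hα hαg using fun i (hi : i ∈ S) => hg hi
    exact ⟨α, hα, Finset.sum_congr rfl hαg⟩
  · rintro ⟨α, hα, rfl⟩
    exact ⟨fun i => α i • u i, fun hi => ⟨_, hα _ hi, rfl⟩, rfl⟩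

lemma mem_zonotope_iff :
    z ∈ zonotope u ↔ ∃ α : Fin n → ℝ, (∀ i, α i ∈ Set.Icc 0 1) ∧ ∑ i, α i • u i = z := by
  rw [zonotope, mem_sum_segment_iff]
  simp only [Finset.mem_univ, true_imp_iff]

lemma mem_tileSet_iff :
    z ∈ tileSet u t ↔ ∃ α : Fin n → ℝ, (∀ i ∈ t.2, α i ∈ Set.Icc 0 1) ∧
      ∑ i ∈ t.1, u i + ∑ i ∈ t.2, α i • u i = z := by
  simp [tileSet, Set.singleton_add, mem_sum_segment_iff, ← eq_sub_iff_add_eq', sub_eq_neg_add]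

/-- The vectors of coefficients in the zonotope of the points of the tile with label `t`. -/
def tileCoeffs (t : TileLabel n) : Set (Fin n → ℝ) :=
  {α | (∀ i, α i ∈ Set.Icc 0 1) ∧ (∀ i ∈ t.1, α i = 1) ∧ ∀ i, i ∉ t.1 → i ∉ t.2 → α i = 0}

lemma ite_mem_tileCoeffs {β : Fin n → ℝ} (hβ : ∀ i ∈ t.2, β i ∈ Set.Icc 0 1) :
    (fun i => if i ∈ t.1 then 1 else if i ∈ t.2 then β i else 0) ∈ tileCoeffs t := by
  refine ⟨fun i => ?_, fun i hi => if_pos hi, fun i h1 h2 => by simp [h1, h2]⟩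
  dsimp only
  split_ifs with h1 h2
  exacts [by simp, hβ i h2, by simp]

lemma tileCoeffs_nonempty (t : TileLabel n) : (tileCoeffs t).Nonempty :=
  ⟨_, ite_mem_tileCoeffs (β := 0) (by simp)⟩

lemma sum_smul_of_mem_tileCoeffs (ht : Disjoint t.1 t.2) (hα : α ∈ tileCoeffs t) :
    ∑ i, α i • u i = ∑ i ∈ t.1, u i + ∑ i ∈ t.2, α i • u i := by
  have hone : ∑ i ∈ t.1, u i = ∑ i ∈ t.1, α i • u i :=
    Finset.sum_congr rfl fun i hi => by rw [hα.2.1 i hi, one_smul]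
  rw [hone, ← Finset.sum_union ht]
  refine (Finset.sum_subset (Finset.subset_univ _) fun i _ hi => ?_).symm
  rw [Finset.mem_union, not_or] at hi
  rw [hα.2.2 i hi.1 hi.2, zero_smul]

lemma mem_tileSet_iff_of_disjoint (ht : Disjoint t.1 t.2) :
    z ∈ tileSet u t ↔ ∃ α ∈ tileCoeffs t, ∑ i, α i • u i = z := by
  rw [mem_tileSet_iff]
  constructor
  · rintro ⟨β, hβ, rfl⟩
    refine ⟨_, ite_mem_tileCoeffs hβ, ?_⟩
    rw [sum_smul_of_mem_tileCoeffs ht (ite_mem_tileCoeffs hβ)]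
    congr 1
    refine Finset.sum_congr rfl fun i hi => ?_
    rw [if_neg (Finset.disjoint_right.1 ht hi), if_pos hi]
  · rintro ⟨α, hα, rfl⟩
    exact ⟨α, fun i _ => hα.1 i, (sum_smul_of_mem_tileCoeffs ht hα).symm⟩

lemma tileSet_subset_zonotope (ht : Disjoint t.1 t.2) : tileSet u t ⊆ zonotope u := by
  intro z hz
  obtain ⟨α, hα, rfl⟩ := (mem_tileSet_iff_of_disjoint ht).1 hz
  exact mem_zonotope_iff.2 ⟨α, hα.1, rfl⟩

lemma vectorSpan_tileSet (u : Fin n → Fin k → ℝ) (t : TileLabel n) :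
    vectorSpan ℝ (tileSet u t) = Submodule.span ℝ (u '' t.2) := by
  have hmem (γ : Fin n → ℝ) : ∑ i ∈ t.2, γ i • u i ∈ Submodule.span ℝ (u '' t.2) :=
    Submodule.sum_mem _ fun i hi =>
      Submodule.smul_mem _ _ (Submodule.subset_span ⟨i, hi, rfl⟩)
  apply le_antisymm
  · rw [vectorSpan_def, Submodule.span_le]
    rintro _ ⟨x, hx, y, hy, rfl⟩
    obtain ⟨α, -, rfl⟩ := mem_tileSet_iff.1 hx
    obtain ⟨β, -, rfl⟩ := mem_tileSet_iff.1 hy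
    simpa using Submodule.sub_mem _ (hmem α) (hmem β)
  · rw [Submodule.span_le]
    rintro _ ⟨b, hb, rfl⟩
    have hcorner : ∑ i ∈ t.1, u i ∈ tileSet u t := mem_tileSet_iff.2 ⟨0, by simp, by simp⟩
    have hvertex : ∑ i ∈ t.1, u i + u b ∈ tileSet u t := by
      refine mem_tileSet_iff.2 ⟨Pi.single b 1, fun i _ => ?_, ?_⟩
      · rcases eq_or_ne i b with rfl | hib <;> simp [*]
      · rw [Finset.sum_eq_single_of_mem b hb fun i _ hib => by simp [hib]]
        simp
    simpa using vsub_mem_vectorSpan ℝ hvertex hcorner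

/- The coefficients `1`, `1/2`, `0` of the barycenter of the smaller tile determine its label. -/
lemma isTileFace_of_tileCoeffs_subset (hf : Disjoint f.1 f.2)
    (hsub : tileCoeffs f ⊆ tileCoeffs t) : IsTileFace f t := by
  obtain ⟨-, hone, hzero⟩ := hsub (ite_mem_tileCoeffs (β := fun _ => 1 / 2) (by norm_num))
  have hone' (i : Fin n) (hi : i ∈ t.1) : i ∈ f.1 := by
    by_contra hif
    have := hone i hi
    by_cases hi2 : i ∈ f.2 <;> norm_num [hif, hi2] at this
  have hzero' (i : Fin n) (hi1 : i ∉ t.1) (hi2 : i ∉ t.2) : i ∉ f.1 ∧ i ∉ f.2 := by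
    have := hzero i hi1 hi2
    by_cases hi1 : i ∈ f.1 <;> by_cases hi2 : i ∈ f.2 <;> simp_all
  refine ⟨fun i hi => ?_, hone', fun i hi => ?_, hf⟩
  · by_contra hi2
    exact (hzero' i (fun hi1 => Finset.disjoint_left.1 hf (hone' i hi1) hi) hi2).2 hi
  · by_contra hit
    rw [Finset.mem_union, not_or] at hit
    exact (hzero' i hit.1 hit.2).1 hi

lemma IsTileFace.eq_of_card_le (hft : IsTileFace f t) (hcard : t.2.card ≤ f.2.card) : f = t := by
  obtain ⟨h2, h1, hf, hdisj⟩ := hft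
  have heq : f.2 = t.2 := Finset.eq_of_subset_of_card_le h2 hcard
  refine Prod.ext (subset_antisymm (fun i hi => ?_) h1) heq
  exact (Finset.mem_union.1 (hf hi)).resolve_right
    fun hit => Finset.disjoint_left.1 hdisj hi (heq ▸ hit)

lemma tileCoeffs_inter (hne : (tileCoeffs t ∩ tileCoeffs t').Nonempty) :
    tileCoeffs t ∩ tileCoeffs t' = tileCoeffs (t.1 ∪ t'.1, t.2 ∩ t'.2) := by
  obtain ⟨γ, ⟨-, hone, hzero⟩, -, hone', hzero'⟩ := hne
  ext α
  simp only [tileCoeffs, Set.mem_inter_iff, Set.mem_ofPred_eq, Finset.mem_union, Finset.mem_inter]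
  constructor
  · rintro ⟨⟨h01, h1, h0⟩, -, h1', h0'⟩
    refine ⟨h01, fun i hi => hi.elim (h1 i) (h1' i), fun i hi hi' => ?_⟩
    rw [not_or] at hi
    by_cases hit : i ∈ t.2
    · exact h0' i hi.2 fun hit' => hi' ⟨hit, hit'⟩
    · exact h0 i hi.1 hit
  · rintro ⟨h01, h1, h0⟩
    refine ⟨⟨h01, fun i hi => h1 i (.inl hi), fun i hi1 hi2 => h0 i ?_ fun hi => hi2 hi.1⟩,
      h01, fun i hi => h1 i (.inr hi), fun i hi1 hi2 => h0 i ?_ fun hi => hi2 hi.2⟩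
    · rintro (hi | hi)
      exacts [hi1 hi, zero_ne_one ((hzero i hi1 hi2).symm.trans (hone' i hi))]
    · rintro (hi | hi)
      exacts [zero_ne_one ((hzero' i hi1 hi2).symm.trans (hone i hi)), hi1 hi]

/-- The label `t` records the signs of `x`: its first part consists of the indices where `x` is
positive, and its second part of those where `x` vanishes. -/
structure IsSignLabel (x : Fin n → ℝ) (t : TileLabel n) : Prop where
  mem_fst_iff : ∀ i, i ∈ t.1 ↔ 0 < x i
  mem_snd_iff : ∀ i, i ∈ t.2 ↔ x i = 0

namespace IsSignLabel

lemma disjoint (ht : IsSignLabel x t) : Disjoint t.1 t.2 :=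
  Finset.disjoint_left.2 fun i h1 h2 =>
    ((ht.mem_fst_iff i).1 h1).ne' ((ht.mem_snd_iff i).1 h2)

lemma mem_tileCoeffs_iff (ht : IsSignLabel x t) (hα : ∀ i, α i ∈ Set.Icc 0 1) :
    α ∈ tileCoeffs t ↔ ∑ i, α i * x i = ∑ i, max 0 (x i) := by
  rw [Finset.sum_eq_sum_iff_of_le fun i _ => mul_le_max_zero (hα i) (x i)]
  simp only [tileCoeffs, Set.mem_ofPred_eq, hα, true_and, ht.mem_fst_iff,
    ht.mem_snd_iff, ← forall_and, Finset.mem_univ, true_imp_iff]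
  refine forall_congr' fun i => ?_
  rcases lt_trichotomy (x i) 0 with hneg | hzero | hpos
  · simp [hneg.not_gt, hneg.ne, hneg.le]
  · simp [hzero]
  · simp [hpos, hpos.le, hpos.ne']

lemma sum_mul_le (ht : IsSignLabel x t) {γ : Fin n → ℝ} (hγ : γ ∈ tileCoeffs t)
    (hα : ∀ i, α i ∈ Set.Icc 0 1) : ∑ i, α i * x i ≤ ∑ i, γ i * x i := by
  rw [(ht.mem_tileCoeffs_iff hγ.1).1 hγ]
  exact Finset.sum_le_sum fun i _ => mul_le_max_zero (hα i) (x i)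

lemma mem_tileCoeffs_of_le (ht : IsSignLabel x t) {γ : Fin n → ℝ} (hγ : γ ∈ tileCoeffs t)
    (hα : ∀ i, α i ∈ Set.Icc 0 1) (hle : ∑ i, γ i * x i ≤ ∑ i, α i * x i) : α ∈ tileCoeffs t := by
  rw [ht.mem_tileCoeffs_iff hα, (ht.sum_mul_le hγ hα).antisymm hle]
  exact (ht.mem_tileCoeffs_iff hγ.1).1 hγ

variable {N : Fin k → ℝ}

lemma faceInDirection_zonotope (ht : IsSignLabel (fun i => N ⬝ᵥ u i) t) :
    faceInDirection (zonotope u) N = tileSet u t := by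
  have hdot (α : Fin n → ℝ) : N ⬝ᵥ ∑ i, α i • u i = ∑ i, α i * (N ⬝ᵥ u i) := by
    simp only [dotProduct_sum, dotProduct_smul, smul_eq_mul]
  ext z
  rw [mem_tileSet_iff_of_disjoint ht.disjoint]
  constructor
  · rintro ⟨hz, hmax⟩
    obtain ⟨α, hα, rfl⟩ := mem_zonotope_iff.1 hz
    obtain ⟨γ, hγ⟩ := tileCoeffs_nonempty t
    have hle := hmax _ (mem_zonotope_iff.2 ⟨γ, hγ.1, rfl⟩)
    rw [hdot, hdot] at hle
    exact ⟨α, ht.mem_tileCoeffs_of_le hγ hα hle, rfl⟩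
  · rintro ⟨α, hα, rfl⟩
    refine ⟨mem_zonotope_iff.2 ⟨α, hα.1, rfl⟩, fun y hy => ?_⟩
    obtain ⟨γ, hγ, rfl⟩ := mem_zonotope_iff.1 hy
    rw [hdot, hdot]
    exact ht.sum_mul_le hα hγ

lemma isTileFace_of_tileSet_subset (ht : IsSignLabel (fun i => N ⬝ᵥ u i) t)
    (hf : Disjoint f.1 f.2) (hsub : tileSet u f ⊆ tileSet u t) : IsTileFace f t := by
  refine isTileFace_of_tileCoeffs_subset hf fun α hα => ?_
  obtain ⟨γ, hγ, hsum⟩ := (mem_tileSet_iff_of_disjoint ht.disjoint).1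
    (hsub ((mem_tileSet_iff_of_disjoint hf).2 ⟨α, hα, rfl⟩))
  refine ht.mem_tileCoeffs_of_le hγ hα.1 (le_of_eq ?_)
  simpa only [dotProduct_sum, dotProduct_smul, smul_eq_mul] using congrArg (N ⬝ᵥ ·) hsum

end IsSignLabel

end Tiles

/-! ### The tiling by the tiles of the vertices -/

section VertexTiles

variable {n : ℕ} {h : Fin n → ℝ} {t t' : TileLabel n}

section

variable {E : Type*} [AddCommGroup E] [Module ℝ E] {v : Fin n → E} {φ φ' : Module.Dual ℝ E}

lemma isSignLabel_excess (v : Fin n → E) (h : Fin n → ℝ) (φ : Module.Dual ℝ E) :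
    IsSignLabel (excess v h φ) (aboveSet v h φ, tightSet v h φ) :=
  ⟨fun _ => mem_aboveSet, fun _ => mem_tightSet⟩

lemma disjoint_of_mem_vertexTiles (ht : t ∈ vertexTiles v h) : Disjoint t.1 t.2 := by
  obtain ⟨φ, -, rfl⟩ := ht
  exact (isSignLabel_excess v h φ).disjoint

lemma sum_mul_height_le (ht : t ∈ vertexTiles v h) {α γ : Fin n → ℝ} (hα : α ∈ tileCoeffs t)
    (hγ : ∀ i, γ i ∈ Set.Icc 0 1) (hsum : ∑ i, α i • v i = ∑ i, γ i • v i) :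
    ∑ i, α i * h i ≤ ∑ i, γ i * h i := by
  obtain ⟨φ, -, rfl⟩ := ht
  have hle := (isSignLabel_excess v h φ).sum_mul_le hα hγ
  rw [sum_mul_excess, sum_mul_excess, hsum] at hle
  linarith

lemma mem_tileCoeffs_of_sum_smul_eq (ht : t ∈ vertexTiles v h) (ht' : t' ∈ vertexTiles v h)
    {α γ : Fin n → ℝ} (hα : α ∈ tileCoeffs t) (hγ : γ ∈ tileCoeffs t')
    (hsum : ∑ i, α i • v i = ∑ i, γ i • v i) : α ∈ tileCoeffs t' := by
  have hheight := sum_mul_height_le ht hα hγ.1 hsum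
  obtain ⟨φ, -, rfl⟩ := ht'
  refine (isSignLabel_excess v h φ).mem_tileCoeffs_of_le hγ hα.1 ?_
  rw [sum_mul_excess, sum_mul_excess, hsum]
  linarith

end

variable {k : ℕ} {v : Fin n → Fin k → ℝ}

lemma tileSet_inter_of_mem_vertexTiles (ht : t ∈ vertexTiles v h) (ht' : t' ∈ vertexTiles v h) :
    tileSet v t ∩ tileSet v t' = ∅ ∨
      ∃ f : TileLabel n, IsTileFace f t ∧ IsTileFace f t' ∧
        tileSet v t ∩ tileSet v t' = tileSet v f := by
  have hdisj := disjoint_of_mem_vertexTiles ht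
  have hdisj' := disjoint_of_mem_vertexTiles ht'
  have hinter (z : Fin k → ℝ) : z ∈ tileSet v t ∩ tileSet v t' ↔
      ∃ α ∈ tileCoeffs t ∩ tileCoeffs t', ∑ i, α i • v i = z := by
    rw [Set.mem_inter_iff, mem_tileSet_iff_of_disjoint hdisj, mem_tileSet_iff_of_disjoint hdisj']
    constructor
    · rintro ⟨⟨α, hα, rfl⟩, γ, hγ, hsum⟩
      exact ⟨α, ⟨hα, mem_tileCoeffs_of_sum_smul_eq ht ht' hα hγ hsum.symm⟩, rfl⟩
    · rintro ⟨α, ⟨hα, hα'⟩, rfl⟩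
      exact ⟨⟨α, hα, rfl⟩, α, hα', rfl⟩
  refine (Set.eq_empty_or_nonempty _).imp_right fun ⟨z, hz⟩ => ?_
  obtain ⟨α, hα, -⟩ := (hinter z).1 hz
  have hcoeffs := tileCoeffs_inter ⟨α, hα⟩
  have hf : Disjoint (t.1 ∪ t'.1) (t.2 ∩ t'.2) := Finset.disjoint_union_left.2
    ⟨hdisj.mono_right Finset.inter_subset_left, hdisj'.mono_right Finset.inter_subset_right⟩
  refine ⟨_, isTileFace_of_tileCoeffs_subset hf (hcoeffs ▸ Set.inter_subset_left),
    isTileFace_of_tileCoeffs_subset hf (hcoeffs ▸ Set.inter_subset_right), ?_⟩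
  ext z
  rw [hinter, mem_tileSet_iff_of_disjoint hf, hcoeffs]

lemma iUnion_tileSet_vertexTiles (hgen : IsGeneric v h)
    (hspan : Submodule.span ℝ (Set.range v) = ⊤) :
    ⋃ t ∈ vertexTiles v h, tileSet v t = zonotope v := by
  refine subset_antisymm (Set.iUnion₂_subset fun t ht =>
    tileSet_subset_zonotope (disjoint_of_mem_vertexTiles ht)) fun z hz => ?_
  obtain ⟨α, hα, hz⟩ := mem_zonotope_iff.1 hz
  obtain ⟨φ, hφ, -, β, hβ, hzβ⟩ := hgen.exists_vertex_sum_eq (S := Finset.univ) (by simpa)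
    (fun i _ => hα i) hz
  rw [Finset.inter_univ] at hzβ
  exact Set.mem_iUnion₂.2 ⟨_, ⟨φ, hφ, rfl⟩, mem_tileSet_iff.2 ⟨β, hβ, hzβ.symm⟩⟩

end VertexTiles

/-! ### Homogeneous coordinates -/

section Homogenize

variable {d : ℕ}

/-- The homogeneous coordinates `(x, 1)` of the point `x`, so that `projLift a i` is by definition
`homogenize (a i)`. -/
def homogenize (x : Fin d → ℝ) : Fin (d + 1) → ℝ :=
  Fin.snoc (α := fun _ => ℝ) x 1

@[simp]
lemma homogenize_castSucc (x : Fin d → ℝ) (j : Fin d) : homogenize x j.castSucc = x j := by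
  simp [homogenize]

@[simp]
lemma homogenize_last (x : Fin d → ℝ) : homogenize x (Fin.last d) = 1 := by
  simp [homogenize]

lemma sum_smul_homogenize_eq_iff {ι : Type*} {S : Finset ι} {c : ι → ℝ} {p : ι → Fin d → ℝ}
    {z : Fin (d + 1) → ℝ} :
    ∑ i ∈ S, c i • homogenize (p i) = z ↔
      ∑ i ∈ S, c i • p i = Fin.init z ∧ ∑ i ∈ S, c i = z (Fin.last d) := by
  simp [funext_iff, Fin.forall_fin_succ', Finset.sum_apply, Fin.init]

lemma affineIndependent_iff_linearIndependent_homogenize {ι : Type*} {p : ι → Fin d → ℝ} :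
    AffineIndependent ℝ p ↔ LinearIndependent ℝ fun i => homogenize (p i) := by
  rw [affineIndependent_iff, linearIndependent_iff']
  refine forall₂_congr fun S c => ?_
  rw [sum_smul_homogenize_eq_iff, and_comm, and_imp]
  rfl

lemma homogenize_smul_sub_add (c : ℝ) (x y z : Fin d → ℝ) :
    homogenize (c • (x - y) + z) = c • (homogenize x - homogenize y) + homogenize z := by
  ext j
  refine Fin.lastCases ?_ (fun j => ?_) j <;> simp

lemma eq_homogenize_add_smul (z : Fin (d + 1) → ℝ) :
    z = homogenize (Fin.init z) + (z (Fin.last d) - 1) • homogenize 0 := by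
  ext j
  refine Fin.lastCases ?_ (fun j => ?_) j <;> simp [Fin.init]

lemma affineSpan_image_eq_top_iff {ι : Type*} {S : Finset ι} {p : ι → Fin d → ℝ} :
    affineSpan ℝ (p '' S) = ⊤ ↔ Submodule.span ℝ ((fun i => homogenize (p i)) '' S) = ⊤ := by
  constructor
  · intro hS
    have hmem (x : Fin d → ℝ) :
        homogenize x ∈ Submodule.span ℝ ((fun i => homogenize (p i)) '' S) := by
      refine affineSpan_induction (hS.ge (AffineSubspace.mem_top ℝ _ x)) ?_
        fun c x y z hx hy hz => ?_
      · rintro _ ⟨i, hi, rfl⟩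
        exact Submodule.subset_span ⟨i, hi, rfl⟩
      · rw [vsub_eq_sub, vadd_eq_add, homogenize_smul_sub_add]
        exact add_mem (Submodule.smul_mem _ _ (sub_mem hx hy)) hz
    refine top_unique fun z _ => ?_
    rw [eq_homogenize_add_smul z]
    exact add_mem (hmem _) (Submodule.smul_mem _ _ (hmem _))
  · intro hS
    refine top_unique fun x _ => ?_
    obtain ⟨c, hc⟩ := (Submodule.mem_span_image_finset_iff_exists_fun' ℝ).1
      (hS.ge (Submodule.mem_top (x := homogenize x)))
    obtain ⟨hx, hsum⟩ := sum_smul_homogenize_eq_iff.1 hc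
    have hx : ∑ i : S, c i • p i = x := by
      rw [Finset.sum_coe_sort S fun i => c i • p i, hx]
      exact Fin.init_snoc ..
    have hsum : ∑ i : S, c i = 1 := by rw [Finset.sum_coe_sort S c, hsum, homogenize_last]
    have hcomb := affineCombination_mem_affineSpan hsum fun i : S => p i
    rw [Finset.affineCombination_eq_linear_combination _ _ _ hsum, hx] at hcomb
    rwa [Set.image_eq_range]

end Homogenize

/-! ### Simplices -/

section Simplex

variable {d n : ℕ} {a : Fin n → Fin d → ℝ} {B Q : Finset (Fin n)} {x : Fin d → ℝ}

lemma sum_smul_projLift_eq_homogenize_iff {c : Fin n → ℝ} :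
    ∑ b ∈ B, c b • projLift a b = homogenize x ↔ ∑ b ∈ B, c b • a b = x ∧ ∑ b ∈ B, c b = 1 := by
  refine sum_smul_homogenize_eq_iff.trans ?_
  rw [homogenize_last, homogenize, Fin.init_snoc]

lemma mem_simplexOf_iff :
    x ∈ simplexOf a B ↔ ∃ c : Fin n → ℝ, (∀ b ∈ B, 0 ≤ c b) ∧
      ∑ b ∈ B, c b • projLift a b = homogenize x := by
  simp only [sum_smul_projLift_eq_homogenize_iff]
  constructor
  · refine fun hx => convexHull_min (t := {x | ∃ c : Fin n → ℝ, (∀ b ∈ B, 0 ≤ c b) ∧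
      ∑ b ∈ B, c b • a b = x ∧ ∑ b ∈ B, c b = 1}) ?_ ?_ hx
    · rintro _ ⟨b, hb, rfl⟩
      refine ⟨Pi.single b 1, fun i _ => ?_, ?_, ?_⟩
      · exact Pi.single_nonneg (α := fun _ => ℝ).2 zero_le_one i
      · rw [Finset.sum_eq_single_of_mem b hb fun i _ hib => by simp [hib]]
        simp
      · simp [Finset.sum_pi_single', Finset.mem_coe.1 hb]
    · rintro _ ⟨c, hc, rfl, hsum⟩ _ ⟨c', hc', rfl, hsum'⟩ s t hs ht hst
      refine ⟨fun b => s * c b + t * c' b, fun b hb =>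
        add_nonneg (mul_nonneg hs (hc b hb)) (mul_nonneg ht (hc' b hb)), ?_, ?_⟩
      · simp only [add_smul, mul_smul, Finset.sum_add_distrib, Finset.smul_sum]
      · rw [Finset.sum_add_distrib, ← Finset.mul_sum, ← Finset.mul_sum, hsum, hsum', mul_one,
          mul_one, hst]
  · rintro ⟨c, hc, rfl, hsum⟩
    exact (convex_convexHull ℝ _).sum_mem hc hsum fun b hb =>
      subset_convexHull ℝ _ ⟨b, hb, rfl⟩

lemma simplexOf_mono {B' : Finset (Fin n)} (hB : B ⊆ B') : simplexOf a B ⊆ simplexOf a B' :=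
  convexHull_mono (Set.image_mono (mod_cast hB))

lemma hullOutside_eq_simplexOf_compl (a : Fin n → Fin d → ℝ) (Q : Finset (Fin n)) :
    hullOutside a Q = simplexOf a Qᶜ := by
  rw [hullOutside, simplexOf, Finset.coe_compl]
  rfl

lemma simplexOf_subset_hullOutside (hB : Disjoint B Q) : simplexOf a B ⊆ hullOutside a Q := by
  rw [hullOutside_eq_simplexOf_compl]
  exact simplexOf_mono (Finset.subset_compl_iff_disjoint_right.2 hB)

lemma isClosed_simplexOf : IsClosed (simplexOf a B) :=
  (Set.toFinite _).isClosed_convexHull ℝ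

lemma interior_simplexOf_nonempty_iff :
    (interior (simplexOf a B)).Nonempty ↔ Submodule.span ℝ (projLift a '' B) = ⊤ := by
  rw [simplexOf, interior_convexHull_nonempty_iff_affineSpan_eq_top]
  exact affineSpan_image_eq_top_iff

lemma card_lt_of_interior_simplexOf_nonempty (hB : (interior (simplexOf a B)).Nonempty) :
    d < B.card := by
  classical
  have hrank := (finrank_span_finset_le_card (R := ℝ) (B.image (projLift a))).trans
    Finset.card_image_le
  rwa [Finset.coe_image, Set.finrank, interior_simplexOf_nonempty_iff.1 hB, finrank_top,
    Module.finrank_fin_fun] at hrank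

lemma closure_interior_simplexOf (hB : (interior (simplexOf a B)).Nonempty) :
    closure (interior (simplexOf a B)) = simplexOf a B :=
  ((convex_convexHull ℝ _).closure_interior_eq_closure_of_nonempty_interior hB).trans
    isClosed_simplexOf.closure_eq

lemma isSimplexIndex_iff : IsSimplexIndex a B ↔
    LinearIndepOn ℝ (projLift a) B ∧ Submodule.span ℝ (projLift a '' B) = ⊤ := by
  have hli : AffineIndependent ℝ (fun b : B => a b) ↔ LinearIndepOn ℝ (projLift a) B :=
    affineIndependent_iff_linearIndependent_homogenize
  rw [IsSimplexIndex, hli, and_comm, Set.image_eq_range]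
  refine and_congr_right fun hB => ⟨fun hcard => ?_, fun hspan => ?_⟩
  · exact LinearIndependent.span_eq_top_of_card_eq_finrank' hB (by simpa using hcard)
  · have hrank := finrank_span_eq_card hB
    rw [← Module.finrank_fin_fun ℝ (n := d + 1), ← finrank_top ℝ (Fin (d + 1) → ℝ), ← hspan]
    exact (Fintype.card_coe B).symm.trans hrank.symm

end Simplex

/-! ### Lifted vectors and heights -/

section Height

variable {d n : ℕ} {a : Fin n → Fin d → ℝ} {h : Fin n → ℝ} {B : Finset (Fin n)}
  {φ : Module.Dual ℝ (Fin (d + 1) → ℝ)}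

/-- The embedding of `ℝ^(d+1)` in `ℝ^(d+2)` as the hyperplane where the height coordinate is given
by the functional `φ`. -/
def graphEmbedding (φ : Module.Dual ℝ (Fin (d + 1) → ℝ)) :
    (Fin (d + 1) → ℝ) →ₗ[ℝ] (Fin (d + 2) → ℝ) where
  toFun z := (heightIndex d).insertNth (α := fun _ => ℝ) (φ z) z
  map_add' x y := by rw [map_add]; exact Fin.insertNth_add ..
  map_smul' c x := by
    ext j
    refine (heightIndex d).succAboveCases ?_ (fun j => ?_) j <;> simp

lemma dropHeight_graphEmbedding (φ : Module.Dual ℝ (Fin (d + 1) → ℝ)) (z : Fin (d + 1) → ℝ) :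
    dropHeight (graphEmbedding φ z) = z :=
  Fin.removeNth_insertNth ..

lemma graphEmbedding_injective (φ : Module.Dual ℝ (Fin (d + 1) → ℝ)) :
    Function.Injective (graphEmbedding φ) :=
  Function.LeftInverse.injective (dropHeight_graphEmbedding φ)

@[simp]
lemma fullLift_heightIndex (i : Fin n) : fullLift a h i (heightIndex d) = h i := by
  simp [fullLift, projLift, heightLift, heightIndex]

@[simp]
lemma dropHeight_fullLift (a : Fin n → Fin d → ℝ) (h : Fin n → ℝ) (i : Fin n) :
    dropHeight (fullLift a h i) = projLift a i := by
  ext j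
  refine Fin.lastCases ?_ (fun j => ?_) j
  · simp [dropHeight, heightIndex, Fin.removeNth, fullLift, projLift]
  · simp [dropHeight, heightIndex, Fin.removeNth, fullLift, projLift, heightLift,
      Fin.succAbove_castSucc_of_lt _ _ (Fin.castSucc_lt_last j)]

lemma fullLift_eq_graphEmbedding {i : Fin n} (hi : excess (projLift a) h φ i = 0) :
    fullLift a h i = graphEmbedding φ (projLift a i) := by
  refine (Fin.eq_insertNth_iff (α := fun _ => ℝ)).2 ⟨?_, dropHeight_fullLift a h i⟩
  rw [fullLift_heightIndex, sub_eq_zero.1 hi]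

lemma finrank_span_fullLift_tightSet_eq_iff :
    Module.finrank ℝ (Submodule.span ℝ (fullLift a h '' tightSet (projLift a) h φ)) = d + 1 ↔
      IsVertex (projLift a) h φ := by
  have himage : fullLift a h '' tightSet (projLift a) h φ =
      graphEmbedding φ '' (projLift a '' tightSet (projLift a) h φ) := by
    rw [Set.image_image]
    exact Set.image_congr fun i hi => fullLift_eq_graphEmbedding (mem_tightSet.1 hi)
  rw [himage, Submodule.span_image,
    ← (Submodule.equivMapOfInjective _ (graphEmbedding_injective φ) _).finrank_eq]
  refine ⟨fun hrank => Submodule.eq_top_of_finrank_eq ?_, fun hφ => ?_⟩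
  · rw [hrank, Module.finrank_fin_fun]
  · rw [hφ, finrank_top, Module.finrank_fin_fun]

lemma eq_zero_of_dotProduct_heightLift_eq (hB : Submodule.span ℝ (projLift a '' B) = ⊤)
    {N : Fin (d + 1) → ℝ} (hlast : N (Fin.last d) = 0) {c : ℝ}
    (hN : ∀ i ∈ B, N ⬝ᵥ heightLift a h i = c) : N = 0 := by
  have hzero : dotProductEquiv ℝ (Fin (d + 1))
      (Fin.snoc (α := fun _ => ℝ) (Fin.init N) (-c)) = 0 := by
    refine LinearMap.ext_on hB ?_
    rintro _ ⟨i, hi, rfl⟩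
    have hNi := hN i hi
    simp only [dotProduct, Fin.sum_univ_castSucc, hlast, heightLift, Fin.snoc_castSucc, zero_mul,
      add_zero] at hNi
    simp [dotProduct, Fin.sum_univ_castSucc, projLift, Fin.init, hNi]
  rw [LinearEquiv.map_eq_zero_iff] at hzero
  ext j
  refine Fin.lastCases hlast (fun j => ?_) j
  simpa [Fin.init] using congrFun hzero j.castSucc

/- `d + 2` lifted points over a spanning set cannot lie on a vertical hyperplane, and if they were
affinely independent they could not all lie on the hyperplane given by a single functional. -/
lemma IsGenericHeight.isGeneric (hgen : IsGenericHeight a h) : IsGeneric (projLift a) h := by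
  intro φ hφ
  obtain ⟨B, hBφ, -, hφB, hB⟩ := exists_linearIndepOn_extension (linearIndepOn_empty ℝ (projLift a))
    (Set.empty_subset (tightSet (projLift a) h φ : Set (Fin n)))
  lift B to Finset (Fin n) using B.toFinite
  have hspan : Submodule.span ℝ (projLift a '' B) = ⊤ :=
    top_unique (hφ.ge.trans (Submodule.span_le.2 hφB))
  suffices heq : tightSet (projLift a) h φ ⊆ B from hB.mono (mod_cast heq)
  intro i hi
  by_contra hiB
  have hcard : (insert i B).card = d + 2 := by
    rw [Finset.card_insert_of_notMem hiB, (isSimplexIndex_iff.2 ⟨hB, hspan⟩).1]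
  have htight (k : (insert i B : Finset (Fin n))) : excess (projLift a) h φ k = 0 :=
    mem_tightSet.1 (Finset.insert_subset hi (mod_cast hBφ) k.2)
  obtain ⟨N, c, hN, hlast, hNc⟩ := hgen _ hcard fun hindep => by
    rw [affineIndependent_iff_linearIndependent_homogenize] at hindep
    have hli : LinearIndependent ℝ fun k : (insert i B : Finset (Fin n)) => projLift a k := by
      refine LinearIndependent.of_comp (graphEmbedding φ) ?_
      convert hindep with k
      exact (fullLift_eq_graphEmbedding (htight k)).symm
    have hle := hli.fintype_card_le_finrank
    rw [Fintype.card_coe, hcard, Module.finrank_fin_fun] at hle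
    omega
  exact hN (eq_zero_of_dotProduct_heightLift_eq hspan hlast fun k hk =>
    hNc k (Finset.mem_insert_of_mem hk))

/- Subtracting from the column of heights the combination of the other columns given by `φ` turns
it into the column of the negative excesses. -/
lemma det_fullLift {e : Fin (d + 1) → Fin n} (he : ∀ r, excess (projLift a) h φ (e r) = 0)
    (i : Fin n) :
    Matrix.det (Matrix.of (Fin.snoc (α := fun _ => Fin (d + 2) → ℝ)
        (fun r => fullLift a h (e r)) (fullLift a h i))) =
      excess (projLift a) h φ i * Matrix.det (Matrix.of fun r => projLift a (e r)) := by
  obtain ⟨w, rfl⟩ := (dotProductEquiv ℝ (Fin (d + 1))).surjective φ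
  set M : Matrix (Fin (d + 2)) (Fin (d + 2)) ℝ := Matrix.of (Fin.snoc
    (α := fun _ => Fin (d + 2) → ℝ) (fun r => fullLift a h (e r)) (fullLift a h i)) with hM
  let c : Fin (d + 2) → ℝ := (heightIndex d).insertNth (α := fun _ => ℝ) 1 (-w)
  have hcol (k : Fin n) : ∑ j, c j * fullLift a h k j =
      -excess (projLift a) h (dotProductEquiv ℝ (Fin (d + 1)) w) k := by
    rw [Fin.sum_univ_succAbove _ (heightIndex d), excess, ← dropHeight_fullLift a h k]
    simp [c, dotProduct, dropHeight, Fin.removeNth, sub_eq_add_neg, add_comm]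
  have hdet := Matrix.det_updateCol_sum M (heightIndex d) c
  rw [show c (heightIndex d) = 1 by simp [c], one_smul] at hdet
  have hsign : (-1 : ℝ) ^ ((Fin.last (d + 1)).val + (heightIndex d).val) = -1 :=
    Odd.neg_one_pow ⟨d, by simp [heightIndex]; ring⟩
  have hminor : ((M.updateCol (heightIndex d) fun k => ∑ j, c j • M k j).submatrix
      (Fin.last (d + 1)).succAbove (heightIndex d).succAbove) =
      Matrix.of fun r => projLift a (e r) := by
    ext r j
    simp [hM, ← dropHeight_fullLift a h, dropHeight, Fin.removeNth]
  rw [← hdet, Matrix.det_succ_column _ (heightIndex d), Fin.sum_univ_castSucc,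
    Finset.sum_eq_zero fun r _ => ?_, zero_add, hminor, hsign, Matrix.updateCol_self]
  · simp [hM, hcol]
  · simp [hM, hcol, he]

lemma det_projLift_ne_zero {e : Fin (d + 1) → Fin n}
    (he : LinearIndependent ℝ fun r => projLift a (e r)) :
    Matrix.det (Matrix.of fun r => projLift a (e r)) ≠ 0 := by
  rw [← isUnit_iff_ne_zero, ← Matrix.isUnit_iff_isUnit_det,
    ← Matrix.linearIndependent_rows_iff_isUnit]
  exact he

/- For `d = 0` there is only one order, but then the determinant is `1`. -/
lemma IsSimplexIndex.exists_det_pos (hB : IsSimplexIndex a B) :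
    ∃ e : Fin (d + 1) → Fin n, Finset.univ.image e = B ∧
      0 < Matrix.det (Matrix.of fun r => projLift a (e r)) := by
  let e := B.orderEmbOfFin hB.1
  have he : Finset.univ.image e = B := B.image_orderEmbOfFin_univ hB.1
  have hli : LinearIndependent ℝ fun r => projLift a (e r) :=
    (isSimplexIndex_iff.1 hB).1.linearIndependent.comp
      (fun r => ⟨e r, B.orderEmbOfFin_mem hB.1 r⟩) fun r s hrs =>
        e.injective (congrArg Subtype.val hrs)
  rcases (det_projLift_ne_zero hli).lt_or_gt with hneg | hpos
  · cases d with
    | zero =>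
      rw [Matrix.det_fin_one] at hneg
      exact absurd (hneg.trans_eq' (homogenize_last (a (e 0)))) zero_lt_one.not_gt
    | succ d =>
      let σ : Equiv.Perm (Fin (d + 2)) := Equiv.swap 0 1
      refine ⟨fun r => e (σ r), ?_, ?_⟩
      · rw [← he]
        ext i
        simp only [Finset.mem_image, Finset.mem_univ, true_and]
        exact (σ.surjective.exists (p := fun r => e r = i)).symm
      · have hswap := Matrix.det_permute σ (Matrix.of fun r => projLift a (e r))
        rw [Equiv.Perm.sign_swap (by simp)] at hswap
        refine lt_of_lt_of_eq ?_ hswap.symm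
        simpa using hneg
  · exact ⟨e, he, hpos⟩

lemma delaunayCondition_tightSet_iff {Q : Finset (Fin n)}
    (hB : IsSimplexIndex a (tightSet (projLift a) h φ)) :
    DelaunayCondition a h Q (tightSet (projLift a) h φ) ↔ aboveSet (projLift a) h φ ⊆ Q := by
  have htight {e : Fin (d + 1) → Fin n}
      (he : Finset.univ.image e = tightSet (projLift a) h φ) (r : Fin (d + 1)) :
      excess (projLift a) h φ (e r) = 0 :=
    mem_tightSet.1 (he ▸ Finset.mem_image_of_mem e (Finset.mem_univ r))
  constructor
  · rintro ⟨e, he, hpos, hdel⟩ i hi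
    by_contra hiQ
    have hneg := hdel i hiQ fun hit => (mem_aboveSet.1 hi).ne' (mem_tightSet.1 hit)
    rw [det_fullLift (htight he)] at hneg
    exact (mul_pos (mem_aboveSet.1 hi) hpos).not_gt hneg
  · intro hQ
    obtain ⟨e, he, hpos⟩ := hB.exists_det_pos
    refine ⟨e, he, hpos, fun i hiQ hit => ?_⟩
    rw [det_fullLift (htight he)]
    exact mul_neg_of_neg_of_pos
      ((excess_nonpos_of_notMem hQ hiQ).lt_of_ne (mt mem_tightSet.2 hit)) hpos

end Height

/-! ### Weighted Delaunay triangulations -/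

section Delaunay

variable {d n : ℕ} {a : Fin n → Fin d → ℝ} {h : Fin n → ℝ} {B B' Q : Finset (Fin n)}
  {x : Fin d → ℝ} {𝒜 : Set (Finset (Fin n))}

/-- The simplices of the weighted Delaunay triangulation of the points with index outside `Q`, read
off from the labels of the vertices of the arrangement. -/
def delaunaySimplices (a : Fin n → Fin d → ℝ) (h : Fin n → ℝ) (Q : Finset (Fin n)) :
    Set (Finset (Fin n)) :=
  {B | Disjoint B Q ∧ ∃ I ⊆ Q, (I, B) ∈ vertexTiles (projLift a) h}

lemma isSimplexIndex_of_mem_vertexTiles (hgen : IsGeneric (projLift a) h) {t : TileLabel n}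
    (ht : t ∈ vertexTiles (projLift a) h) : IsSimplexIndex a t.2 := by
  obtain ⟨φ, hφ, rfl⟩ := ht
  exact isSimplexIndex_iff.2 ⟨hgen φ hφ, hφ⟩

lemma mem_delaunaySimplices_iff (hgen : IsGeneric (projLift a) h) :
    B ∈ delaunaySimplices a h Q ↔
      IsSimplexIndex a B ∧ Disjoint B Q ∧ DelaunayCondition a h Q B := by
  constructor
  · rintro ⟨hBQ, I, hIQ, hIB⟩
    have hB := isSimplexIndex_of_mem_vertexTiles hgen hIB
    obtain ⟨φ, -, heq⟩ := hIB
    obtain ⟨rfl, rfl⟩ := Prod.mk.inj heq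
    exact ⟨hB, hBQ, (delaunayCondition_tightSet_iff hB).2 hIQ⟩
  · rintro ⟨hB, hBQ, hdel⟩
    obtain ⟨hli, hspan⟩ := isSimplexIndex_iff.1 hB
    obtain ⟨φ, hφ, rfl⟩ := hgen.exists_tightSet_eq hli hspan
    exact ⟨hBQ, _, (delaunayCondition_tightSet_iff hB).1 hdel, φ, hφ, rfl⟩

lemma interior_simplexOf_nonempty (hB : B ∈ delaunaySimplices a h Q) :
    (interior (simplexOf a B)).Nonempty := by
  obtain ⟨-, I, -, φ, hφ, heq⟩ := hB
  obtain ⟨-, rfl⟩ := Prod.mk.inj heq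
  exact interior_simplexOf_nonempty_iff.2 hφ

section

variable {φ φ' : Module.Dual ℝ (Fin (d + 1) → ℝ)}

lemma apply_homogenize_le_of_mem_simplexOf (hdisj : Disjoint (tightSet (projLift a) h φ) Q)
    (hQ : aboveSet (projLift a) h φ' ⊆ Q) (hx : x ∈ simplexOf a (tightSet (projLift a) h φ)) :
    φ' (homogenize x) ≤ φ (homogenize x) := by
  obtain ⟨c, hc, hcx⟩ := mem_simplexOf_iff.1 hx
  rw [← sub_nonpos, ← hcx, ← sum_tightSet_mul_excess]
  exact Finset.sum_nonpos fun b hb => mul_nonpos_of_nonneg_of_nonpos (hc b hb)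
    (excess_nonpos_of_notMem hQ (Finset.disjoint_left.1 hdisj hb))

lemma mem_simplexOf_inter_of_apply_homogenize_eq
    (hdisj : Disjoint (tightSet (projLift a) h φ) Q) (hQ : aboveSet (projLift a) h φ' ⊆ Q)
    (hx : x ∈ simplexOf a (tightSet (projLift a) h φ))
    (heq : φ' (homogenize x) = φ (homogenize x)) :
    x ∈ simplexOf a (tightSet (projLift a) h φ ∩ tightSet (projLift a) h φ') := by
  obtain ⟨c, hc, hcx⟩ := mem_simplexOf_iff.1 hx
  rw [← sub_eq_zero, ← hcx, ← sum_tightSet_mul_excess, Finset.sum_eq_zero_iff_of_nonpos fun b hb =>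
    mul_nonpos_of_nonneg_of_nonpos (hc b hb)
      (excess_nonpos_of_notMem hQ (Finset.disjoint_left.1 hdisj hb))] at heq
  refine mem_simplexOf_iff.2 ⟨c, fun b hb => hc b (Finset.mem_inter.1 hb).1, ?_⟩
  rw [← hcx]
  refine Finset.sum_subset Finset.inter_subset_left fun b hb hb' => ?_
  have hne : excess (projLift a) h φ' b ≠ 0 := fun h0 =>
    hb' (Finset.mem_inter.2 ⟨hb, mem_tightSet.2 h0⟩)
  rw [(mul_eq_zero.1 (heq b hb)).resolve_right hne, zero_smul]

end

lemma simplexOf_inter (hB : B ∈ delaunaySimplices a h Q) (hB' : B' ∈ delaunaySimplices a h Q) :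
    simplexOf a B ∩ simplexOf a B' = simplexOf a (B ∩ B') := by
  refine subset_antisymm ?_ (Set.subset_inter (simplexOf_mono Finset.inter_subset_left)
    (simplexOf_mono Finset.inter_subset_right))
  obtain ⟨hBQ, I, hIQ, φ, -, heq⟩ := hB
  obtain ⟨hBQ', I', hIQ', φ', -, heq'⟩ := hB'
  obtain ⟨rfl, rfl⟩ := Prod.mk.inj heq
  obtain ⟨rfl, rfl⟩ := Prod.mk.inj heq'
  exact fun x hx => mem_simplexOf_inter_of_apply_homogenize_eq hBQ hIQ' hx.1 <|
    (apply_homogenize_le_of_mem_simplexOf hBQ hIQ' hx.1).antisymm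
      (apply_homogenize_le_of_mem_simplexOf hBQ' hIQ hx.2)

lemma disjoint_interior_simplexOf (hgen : IsGeneric (projLift a) h)
    (hB : B ∈ delaunaySimplices a h Q) (hB' : B' ∈ delaunaySimplices a h Q) (hne : B ≠ B') :
    Disjoint (interior (simplexOf a B)) (simplexOf a B') := by
  rw [← closure_interior_simplexOf (interior_simplexOf_nonempty hB')]
  refine Disjoint.closure_right ?_ isOpen_interior
  rw [Set.disjoint_iff_inter_eq_empty, ← interior_inter, simplexOf_inter hB hB',
    ← Set.not_nonempty_iff_eq_empty]
  intro hint
  have hcard : d + 1 ≤ (B ∩ B').card := card_lt_of_interior_simplexOf_nonempty hint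
  refine hne (subset_antisymm ?_ ?_)
  · rw [← Finset.inter_eq_left]
    refine Finset.eq_of_subset_of_card_le Finset.inter_subset_left ?_
    rwa [((mem_delaunaySimplices_iff hgen).1 hB).1.1]
  · rw [← Finset.inter_eq_right]
    refine Finset.eq_of_subset_of_card_le Finset.inter_subset_right ?_
    rwa [((mem_delaunaySimplices_iff hgen).1 hB').1.1]

lemma mem_of_simplexOf_subset_iUnion (hgen : IsGeneric (projLift a) h)
    (hB : B ∈ delaunaySimplices a h Q) (h𝒜 : 𝒜 ⊆ delaunaySimplices a h Q)
    (hsub : simplexOf a B ⊆ ⋃ C ∈ 𝒜, simplexOf a C) : B ∈ 𝒜 := by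
  obtain ⟨x, hx⟩ := interior_simplexOf_nonempty hB
  obtain ⟨C, hC, hxC⟩ := Set.mem_iUnion₂.1 (hsub (interior_subset hx))
  rcases eq_or_ne B C with rfl | hne
  · exact hC
  · exact absurd hxC
      (Set.disjoint_left.1 (disjoint_interior_simplexOf hgen hB (h𝒜 hC) hne) hx)

lemma eq_empty_of_sum_projLift_add_eq {S : Finset (Fin n)} {β : Fin n → ℝ}
    {z : Fin (d + 1) → ℝ} (hβ : ∀ b ∈ B, 0 ≤ β b)
    (hz : ∑ i ∈ S, projLift a i + ∑ b ∈ B, β b • projLift a b = z) (hlast : z (Fin.last d) < 1) :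
    S = ∅ := by
  have hcard : (S.card : ℝ) + ∑ b ∈ B, β b = z (Fin.last d) := by
    simpa [projLift] using congrFun hz (Fin.last d)
  have hlt : (S.card : ℝ) < (1 : ℕ) := by
    rw [Nat.cast_one]
    linarith [Finset.sum_nonneg hβ]
  simpa using hlt

/- Half of the homogeneous coordinates of `x` has last coordinate less than `1`, so the tile that
contains it has no vector added to its segments. -/
lemma exists_mem_delaunaySimplices_mem_simplexOf (hgen : IsGeneric (projLift a) h)
    (hQ : (interior (hullOutside a Q)).Nonempty) (hx : x ∈ hullOutside a Q) :
    ∃ B ∈ delaunaySimplices a h Q, x ∈ simplexOf a B := by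
  rw [hullOutside_eq_simplexOf_compl] at hx hQ
  obtain ⟨c, hc, hcx⟩ := mem_simplexOf_iff.1 hx
  have hc1 := (sum_smul_projLift_eq_homogenize_iff.1 hcx).2
  have hα (i : Fin n) (hi : i ∈ Qᶜ) : 2⁻¹ * c i ∈ Set.Icc (0 : ℝ) 1 := by
    have hci := Finset.single_le_sum hc hi
    exact ⟨by linarith [hc i hi], by linarith⟩
  have hsum : ∑ i ∈ Qᶜ, (2⁻¹ * c i) • projLift a i = (2⁻¹ : ℝ) • homogenize x := by
    simp only [mul_smul, ← Finset.smul_sum, hcx]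
  obtain ⟨φ, hφ, hφQ, β, hβ, hz⟩ :=
    hgen.exists_vertex_sum_eq (interior_simplexOf_nonempty_iff.1 hQ) hα hsum
  have habove : aboveSet (projLift a) h φ ∩ Qᶜ = ∅ :=
    eq_empty_of_sum_projLift_add_eq (fun b hb => (hβ b hb).1) hz.symm (by norm_num)
  refine ⟨_, ⟨Finset.subset_compl_iff_disjoint_right.1 hφQ, _, ?_, φ, hφ, rfl⟩,
    mem_simplexOf_iff.2 ⟨fun b => 2 * β b, fun b hb => mul_nonneg zero_le_two (hβ b hb).1, ?_⟩⟩
  · rwa [← Finset.disjoint_iff_inter_eq_empty, disjoint_compl_right_iff] at habove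
  · rw [habove, Finset.sum_empty, zero_add] at hz
    simp only [mul_smul, ← Finset.smul_sum, ← hz]
    exact smul_inv_smul₀ two_ne_zero _

lemma iUnion_delaunaySimplices (hgen : IsGeneric (projLift a) h)
    (hQ : (interior (hullOutside a Q)).Nonempty) :
    ⋃ B ∈ delaunaySimplices a h Q, simplexOf a B = hullOutside a Q :=
  subset_antisymm (Set.iUnion₂_subset fun _ hB => simplexOf_subset_hullOutside hB.1) fun _ hx =>
    Set.mem_iUnion₂.2 (by simpa using exists_mem_delaunaySimplices_mem_simplexOf hgen hQ hx)

lemma isWeightedDelaunay_of_subset (hgen : IsGeneric (projLift a) h)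
    (h𝒜 : 𝒜 ⊆ delaunaySimplices a h Q) {R : Set (Fin d → ℝ)}
    (hR : ⋃ B ∈ 𝒜, simplexOf a B = R) : IsWeightedDelaunay a h Q R 𝒜 where
  triangulation :=
    { simplex := fun B hB => ((mem_delaunaySimplices_iff hgen).1 (h𝒜 hB)).1
      injOn := fun B hB B' hB' heq => by
        have hmem := mem_of_simplexOf_subset_iUnion hgen (h𝒜 hB)
          (Set.singleton_subset_iff.2 (h𝒜 hB')) (by simpa using heq.subset)
        exact Set.mem_singleton_iff.1 hmem
      cover := hR
      inter := fun B hB B' hB' => ⟨B ∩ B', Finset.inter_subset_left, B ∩ B',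
        Finset.inter_subset_right, simplexOf_inter (h𝒜 hB) (h𝒜 hB'),
        simplexOf_inter (h𝒜 hB) (h𝒜 hB')⟩ }
  outside := fun B hB => (h𝒜 hB).1
  delaunay := fun B hB => ((mem_delaunaySimplices_iff hgen).1 (h𝒜 hB)).2.2

lemma IsWeightedDelaunay.eq_delaunaySimplices (hgen : IsGeneric (projLift a) h)
    {T : Set (Finset (Fin n))} (hT : IsWeightedDelaunay a h Q (hullOutside a Q) T) :
    T = delaunaySimplices a h Q := by
  have hsub : T ⊆ delaunaySimplices a h Q := fun B hB => (mem_delaunaySimplices_iff hgen).2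
    ⟨hT.triangulation.simplex B hB, hT.outside B hB, hT.delaunay B hB⟩
  refine hsub.antisymm fun B hB => mem_of_simplexOf_subset_iUnion hgen hB hsub ?_
  rw [hT.triangulation.cover]
  exact simplexOf_subset_hullOutside hB.1

lemma existsUnique_isWeightedDelaunay (hgen : IsGeneric (projLift a) h)
    (hQ : (interior (hullOutside a Q)).Nonempty) :
    ∃! T : Set (Finset (Fin n)), IsWeightedDelaunay a h Q (hullOutside a Q) T :=
  ⟨delaunaySimplices a h Q,
    isWeightedDelaunay_of_subset hgen subset_rfl (iUnion_delaunaySimplices hgen hQ),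
    fun _ hT => hT.eq_delaunaySimplices hgen⟩

lemma closure_interior_hullOutside_diff (hgen : IsGeneric (projLift a) h)
    (hQ : (interior (hullOutside a Q)).Nonempty) (h𝒜 : 𝒜 ⊆ delaunaySimplices a h Q) :
    closure (interior (hullOutside a Q \ ⋃ B ∈ delaunaySimplices a h Q \ 𝒜, simplexOf a B)) =
      ⋃ B ∈ 𝒜, simplexOf a B := by
  refine subset_antisymm (closure_minimal (interior_subset.trans ?_)
    ((Set.toFinite 𝒜).isClosed_biUnion fun _ _ => isClosed_simplexOf))
    (Set.iUnion₂_subset fun B hB => ?_)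
  · rintro x ⟨hx, hx'⟩
    obtain ⟨B, hB, hxB⟩ := exists_mem_delaunaySimplices_mem_simplexOf hgen hQ hx
    refine Set.mem_iUnion₂.2 ⟨B, by_contra fun hB𝒜 => hx' ?_, hxB⟩
    exact Set.mem_iUnion₂.2 ⟨B, ⟨hB, hB𝒜⟩, hxB⟩
  · rw [← closure_interior_simplexOf (interior_simplexOf_nonempty (h𝒜 hB))]
    refine closure_mono (interior_maximal (fun x hx => ?_) isOpen_interior)
    refine ⟨simplexOf_subset_hullOutside (h𝒜 hB).1 (interior_subset hx), fun hx' => ?_⟩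
    obtain ⟨C, ⟨hC, hC𝒜⟩, hxC⟩ := Set.mem_iUnion₂.1 hx'
    have hne : B ≠ C := fun heq => hC𝒜 (heq ▸ hB)
    exact Set.disjoint_left.1 (disjoint_interior_simplexOf hgen (h𝒜 hB) hC hne) hx hxC

end Delaunay

lemma isFineZonotopalTiling_vertexTiles {d n : ℕ} {a : Fin n → Fin d → ℝ} {h : Fin n → ℝ}
    (hgen : IsGeneric (projLift a) h) (hspan : Submodule.span ℝ (Set.range (projLift a)) = ⊤) :
    IsFineZonotopalTiling a (vertexTiles (projLift a) h) where
  disjoint := fun _ ht => disjoint_of_mem_vertexTiles ht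
  simplex := fun _ ht => isSimplexIndex_of_mem_vertexTiles hgen ht
  cover := iUnion_tileSet_vertexTiles hgen hspan
  inter := fun _ ht _ ht' => tileSet_inter_of_mem_vertexTiles ht ht'

/-! ### Facets of the lifted zonotope -/

section Facets

variable {d n : ℕ} {a : Fin n → Fin d → ℝ} {h : Fin n → ℝ} {σ : ℝ}
  {F : Set (Fin (d + 2) → ℝ)}

lemma image_dropHeight_tileSet (t : TileLabel n) :
    dropHeight '' tileSet (fullLift a h) t = tileSet (projLift a) t := by
  have hdrop (α : Fin n → ℝ) :
      dropHeight (∑ i ∈ t.1, fullLift a h i + ∑ i ∈ t.2, α i • fullLift a h i) =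
        ∑ i ∈ t.1, projLift a i + ∑ i ∈ t.2, α i • projLift a i := by
    ext j
    simp [← dropHeight_fullLift a h, dropHeight, Fin.removeNth]
  ext z
  simp only [Set.mem_image, mem_tileSet_iff]
  constructor
  · rintro ⟨-, ⟨α, hα, rfl⟩, rfl⟩
    exact ⟨α, hα, (hdrop α).symm⟩
  · rintro ⟨α, hα, rfl⟩
    exact ⟨_, ⟨α, hα, rfl⟩, hdrop α⟩

lemma dotProduct_fullLift (N : Fin (d + 2) → ℝ) (i : Fin n) :
    N ⬝ᵥ fullLift a h i = N (heightIndex d) * h i + dropHeight N ⬝ᵥ projLift a i := by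
  rw [dotProduct, Fin.sum_univ_succAbove _ (heightIndex d), fullLift_heightIndex,
    ← dropHeight_fullLift a h]
  rfl

lemma isSignLabel_dotProduct_fullLift {N : Fin (d + 2) → ℝ} {w : Fin (d + 1) → ℝ}
    (hN : N (heightIndex d) * σ < 0) (hw : dropHeight N = (-(N (heightIndex d) * σ)) • w) :
    IsSignLabel (fun i => N ⬝ᵥ fullLift a (σ • h) i)
      (aboveSet (projLift a) h (dotProductEquiv ℝ _ w),
        tightSet (projLift a) h (dotProductEquiv ℝ _ w)) := by
  have hdot (i : Fin n) : N ⬝ᵥ fullLift a (σ • h) i =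
      -(N (heightIndex d) * σ) * excess (projLift a) h (dotProductEquiv ℝ _ w) i := by
    rw [dotProduct_fullLift, hw, smul_dotProduct, Pi.smul_apply, smul_eq_mul, smul_eq_mul, excess,
      dotProductEquiv_apply_apply]
    ring
  simp only [hdot]
  exact ⟨fun i => mem_aboveSet.trans (mul_pos_iff_of_pos_left (neg_pos.2 hN)).symm, fun i =>
    mem_tightSet.trans (mul_eq_zero.trans (or_iff_right (neg_pos.2 hN).ne')).symm⟩

lemma exists_isSignLabel_of_normal {N : Fin (d + 2) → ℝ} (hN : N (heightIndex d) * σ < 0) :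
    ∃ φ, IsSignLabel (fun i => N ⬝ᵥ fullLift a (σ • h) i)
      (aboveSet (projLift a) h φ, tightSet (projLift a) h φ) :=
  ⟨_, isSignLabel_dotProduct_fullLift (w := (-(N (heightIndex d) * σ))⁻¹ • dropHeight N) hN
    (smul_inv_smul₀ (neg_pos.2 hN).ne' _).symm⟩

lemma exists_normal_isSignLabel (hσ : σ ≠ 0) (φ : Module.Dual ℝ (Fin (d + 1) → ℝ)) :
    ∃ N : Fin (d + 2) → ℝ, N (heightIndex d) * σ < 0 ∧
      IsSignLabel (fun i => N ⬝ᵥ fullLift a (σ • h) i)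
        (aboveSet (projLift a) h φ, tightSet (projLift a) h φ) := by
  obtain ⟨w, rfl⟩ := (dotProductEquiv ℝ (Fin (d + 1))).surjective φ
  let N : Fin (d + 2) → ℝ := (heightIndex d).insertNth (α := fun _ => ℝ) (-σ⁻¹) w
  have hN : N (heightIndex d) * σ = -1 := by simp [N, hσ]
  refine ⟨N, hN.trans_lt neg_one_lt_zero, isSignLabel_dotProduct_fullLift
    (hN.trans_lt neg_one_lt_zero) ?_⟩
  rw [hN, neg_neg, one_smul]
  exact Fin.removeNth_insertNth ..

lemma finrank_vectorSpan_tileSet_eq_iff (hσ : σ ≠ 0) {φ : Module.Dual ℝ (Fin (d + 1) → ℝ)} :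
    Module.finrank ℝ (vectorSpan ℝ (tileSet (fullLift a (σ • h))
        (aboveSet (projLift a) h φ, tightSet (projLift a) h φ))) = d + 1 ↔
      IsVertex (projLift a) h φ := by
  rw [vectorSpan_tileSet, IsVertex, ← tightSet_smul hσ]
  exact finrank_span_fullLift_tightSet_eq_iff

/- The sign of `σ` selects the side: the lifted tiles form the lower hull for the heights `h` and,
turned upside down, the upper hull for the heights `-h`. -/
lemma exists_normal_and_finrank_iff (hσ : σ ≠ 0) :
    ((∃ N : Fin (d + 2) → ℝ, N (heightIndex d) * σ < 0 ∧
        F = faceInDirection (zonotope (fullLift a (σ • h))) N) ∧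
      Module.finrank ℝ (vectorSpan ℝ F) = d + 1) ↔
    ∃ t ∈ vertexTiles (projLift a) h, F = tileSet (fullLift a (σ • h)) t := by
  constructor
  · rintro ⟨⟨N, hN, rfl⟩, hrank⟩
    obtain ⟨φ, hφ⟩ := exists_isSignLabel_of_normal (a := a) (h := h) hN
    rw [hφ.faceInDirection_zonotope, finrank_vectorSpan_tileSet_eq_iff hσ] at hrank
    exact ⟨_, ⟨φ, hrank, rfl⟩, hφ.faceInDirection_zonotope⟩
  · rintro ⟨_, ⟨φ, hφ, rfl⟩, rfl⟩
    obtain ⟨N, hN, hsign⟩ := exists_normal_isSignLabel (a := a) (h := h) hσ φ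
    exact ⟨⟨N, hN, hsign.faceInDirection_zonotope.symm⟩,
      (finrank_vectorSpan_tileSet_eq_iff hσ).2 hφ⟩

lemma isLowerFacet_iff : IsLowerFacet (zonotope (fullLift a h)) F ↔
    ∃ t ∈ vertexTiles (projLift a) h, F = tileSet (fullLift a h) t := by
  simpa only [IsLowerFacet, one_smul, mul_one] using
    exists_normal_and_finrank_iff (a := a) (h := h) (F := F) one_ne_zero

lemma isUpperFacet_iff : IsUpperFacet (zonotope (fullLift a (-h))) F ↔
    ∃ t ∈ vertexTiles (projLift a) h, F = tileSet (fullLift a (-h)) t := by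
  simpa only [IsUpperFacet, neg_smul, one_smul, mul_neg, mul_one, neg_lt_zero] using
    exists_normal_and_finrank_iff (a := a) (h := h) (F := F) (neg_ne_zero.2 one_ne_zero)

lemma lowerHullLabels_eq (hgen : IsGeneric (projLift a) h) :
    lowerHullLabels a h = vertexTiles (projLift a) h := by
  ext t
  constructor
  · rintro ⟨hdisj, hcard, hF⟩
    obtain ⟨t', ht', heq⟩ := isLowerFacet_iff.1 hF
    have hcard' := (isSimplexIndex_of_mem_vertexTiles hgen ht').1
    obtain ⟨φ, -, rfl⟩ := id ht'
    obtain ⟨N, -, hsign⟩ := exists_normal_isSignLabel (a := a) (h := h) one_ne_zero φ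
    rw [one_smul] at hsign
    have hface := hsign.isTileFace_of_tileSet_subset hdisj heq.subset
    exact hface.eq_of_card_le (hcard'.trans hcard.symm).le ▸ ht'
  · intro ht
    exact ⟨disjoint_of_mem_vertexTiles ht, (isSimplexIndex_of_mem_vertexTiles hgen ht).1,
      isLowerFacet_iff.2 ⟨t, ht, rfl⟩⟩

lemma image_tileSet_eq_of_facet_iff {P : Set (TileLabel n)}
    {IsFacet : Set (Fin (d + 2) → ℝ) → Prop}
    (hP : ∀ F, IsFacet F ↔ ∃ t ∈ P, F = tileSet (fullLift a h) t) :
    tileSet (projLift a) '' P = {G | ∃ F, IsFacet F ∧ G = dropHeight '' F} := by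
  ext G
  constructor
  · rintro ⟨t, ht, rfl⟩
    exact ⟨_, (hP _).2 ⟨t, ht, rfl⟩, (image_dropHeight_tileSet t).symm⟩
  · rintro ⟨F, hF, rfl⟩
    obtain ⟨t, ht, rfl⟩ := (hP F).1 hF
    exact ⟨t, ht, (image_dropHeight_tileSet t).symm⟩

lemma image_tileSet_vertexTiles : tileSet (projLift a) '' vertexTiles (projLift a) h =
    {G | ∃ F, IsLowerFacet (zonotope (fullLift a h)) F ∧ G = dropHeight '' F} :=
  image_tileSet_eq_of_facet_iff fun _ => isLowerFacet_iff

lemma isRegularTiling_vertexTiles : IsRegularTiling a (vertexTiles (projLift a) h) :=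
  ⟨n, fullLift a (-h), image_tileSet_eq_of_facet_iff fun _ => isUpperFacet_iff⟩

end Facets

/-! ### The iterative construction -/

section Construction

variable {d n : ℕ} {a : Fin n → Fin d → ℝ} {h : Fin n → ℝ} {t : TileLabel n} {Q : Finset (Fin n)}

lemma mem_delaunaySimplices_of_mem_vertexTiles (ht : t ∈ vertexTiles (projLift a) h) :
    t.2 ∈ delaunaySimplices a h t.1 :=
  ⟨(disjoint_of_mem_vertexTiles ht).symm, t.1, subset_rfl, ht⟩

lemma setOf_mem_vertexTiles_subset_delaunaySimplices (Q : Finset (Fin n)) :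
    {B | (Q, B) ∈ vertexTiles (projLift a) h} ⊆ delaunaySimplices a h Q :=
  fun _ hB => mem_delaunaySimplices_of_mem_vertexTiles hB

lemma interior_hullOutside_nonempty (ht : t ∈ vertexTiles (projLift a) h) :
    (interior (hullOutside a t.1)).Nonempty :=
  (interior_simplexOf_nonempty (mem_delaunaySimplices_of_mem_vertexTiles ht)).mono <|
    interior_mono (simplexOf_subset_hullOutside (disjoint_of_mem_vertexTiles ht).symm)

lemma card_add_le_of_mem_vertexTiles (hgen : IsGeneric (projLift a) h)
    (ht : t ∈ vertexTiles (projLift a) h) : t.1.card + d + 1 ≤ n := by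
  have hcard := Finset.card_union_of_disjoint (disjoint_of_mem_vertexTiles ht)
  have hle := Finset.card_le_univ (t.1 ∪ t.2)
  rw [hcard, (isSimplexIndex_of_mem_vertexTiles hgen ht).1, Fintype.card_fin] at hle
  lia

lemma iUnion_linkPart_vertexTiles (Q : Finset (Fin n)) :
    ⋃ r ∈ Finset.range Q.card,
        linkPart a {t ∈ vertexTiles (projLift a) h | t.1.card < Q.card} r Q =
      ⋃ B ∈ delaunaySimplices a h Q \ {B | (Q, B) ∈ vertexTiles (projLift a) h},
        simplexOf a B := by
  ext x
  simp only [linkPart, Set.mem_iUnion]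
  constructor
  · rintro ⟨r, -, t, ⟨⟨ht, hcard⟩, -, hdisj, hsub⟩, hx⟩
    refine ⟨t.2, ⟨⟨hdisj, t.1, hsub, ht⟩, fun hmem => ?_⟩, hx⟩
    exact hcard.ne (congrArg Finset.card (eq_of_mem_vertexTiles ht hmem))
  · rintro ⟨B, ⟨⟨hdisj, I, hIQ, hIB⟩, hB⟩, hx⟩
    have hlt : I.card < Q.card :=
      Finset.card_lt_card (hIQ.ssubset_of_ne fun heq => hB (heq ▸ hIB))
    exact ⟨I.card, Finset.mem_range.2 hlt, (I, B), ⟨⟨hIB, hlt⟩, rfl, hdisj, hIQ⟩, hx⟩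

lemma linkRegion_vertexTiles (hgen : IsGeneric (projLift a) h) (Q : Finset (Fin n)) :
    linkRegion a {t ∈ vertexTiles (projLift a) h | t.1.card < Q.card} Q =
      ⋃ B ∈ {B | (Q, B) ∈ vertexTiles (projLift a) h}, simplexOf a B := by
  by_cases hQ : (interior (hullOutside a Q)).Nonempty
  · rw [linkRegion, iUnion_linkPart_vertexTiles, closure_interior_hullOutside_diff hgen hQ
      (setOf_mem_vertexTiles_subset_delaunaySimplices Q)]
  · have hnone : {B | (Q, B) ∈ vertexTiles (projLift a) h} = ∅ :=
      Set.eq_empty_iff_forall_notMem.2 fun B hB =>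
        hQ (interior_hullOutside_nonempty (t := (Q, B)) hB)
    rw [hnone, Set.biUnion_empty, linkRegion, closure_empty_iff, ← Set.subset_empty_iff,
      ← Set.not_nonempty_iff_eq_empty.1 hQ]
    exact interior_mono Set.sdiff_subset

lemma linkRegion_vertexTiles_nonempty_iff (hgen : IsGeneric (projLift a) h) :
    (linkRegion a {t ∈ vertexTiles (projLift a) h | t.1.card < Q.card} Q).Nonempty ↔
      ∃ B, (Q, B) ∈ vertexTiles (projLift a) h := by
  rw [linkRegion_vertexTiles hgen, Set.nonempty_biUnion]
  refine exists_congr fun B => and_iff_left_of_imp fun hB => ?_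
  exact (interior_simplexOf_nonempty (mem_delaunaySimplices_of_mem_vertexTiles hB)).mono
    interior_subset

variable {T : Finset (Fin n) → Set (Finset (Fin n))}

lemma linkSimplices_vertexTiles (hgen : IsGeneric (projLift a) h)
    (hT : T Q = delaunaySimplices a h Q) :
    linkSimplices a T {t ∈ vertexTiles (projLift a) h | t.1.card < Q.card} Q =
      {B | (Q, B) ∈ vertexTiles (projLift a) h} := by
  have hsub := setOf_mem_vertexTiles_subset_delaunaySimplices (a := a) (h := h) Q
  ext B
  rw [linkSimplices, linkRegion_vertexTiles hgen, hT]
  exact ⟨fun hB => mem_of_simplexOf_subset_iUnion hgen hB.1 hsub hB.2,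
    fun hB => ⟨hsub hB, Set.subset_biUnion_of_mem (u := simplexOf a) hB⟩⟩

lemma newTiles_vertexTiles (hgen : IsGeneric (projLift a) h)
    (hT : ∀ Q, (interior (hullOutside a Q)).Nonempty → T Q = delaunaySimplices a h Q) (k : ℕ) :
    newTiles a T {I | I.card = k ∧ ∃ B, (I, B) ∈ vertexTiles (projLift a) h}
        {t ∈ vertexTiles (projLift a) h | t.1.card < k} =
      {t ∈ vertexTiles (projLift a) h | t.1.card = k} := by
  ext t
  constructor
  · rintro ⟨⟨rfl, B, hB⟩, ht⟩
    rw [linkSimplices_vertexTiles hgen (hT _ (interior_hullOutside_nonempty hB))] at ht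
    exact ⟨ht, rfl⟩
  · rintro ⟨ht, rfl⟩
    refine ⟨⟨rfl, t.2, ht⟩, ?_⟩
    rwa [linkSimplices_vertexTiles hgen (hT _ (interior_hullOutside_nonempty ht))]

lemma exists_empty_mem_vertexTiles (hgen : IsGeneric (projLift a) h)
    (hspan : affineSpan ℝ (Set.range a) = ⊤) :
    ∃ B, (∅, B) ∈ vertexTiles (projLift a) h := by
  have hint : (interior (hullOutside a ∅)).Nonempty := by
    simpa [hullOutside, interior_convexHull_nonempty_iff_affineSpan_eq_top] using hspan
  obtain ⟨x, hx⟩ := hint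
  obtain ⟨B, ⟨-, I, hI, hIB⟩, -⟩ :=
    exists_mem_delaunaySimplices_mem_simplexOf hgen ⟨x, hx⟩ (interior_subset hx)
  exact ⟨B, Finset.subset_empty.1 hI ▸ hIB⟩

lemma exists_insert_linkRegion_nonempty_iff (hgen : IsGeneric (projLift a) h) (k : ℕ)
    (J : Finset (Fin n)) :
    (∃ t ∈ {t ∈ vertexTiles (projLift a) h | t.1.card = k}, ∃ b ∈ t.2, J = insert b t.1 ∧
        (linkRegion a {t ∈ vertexTiles (projLift a) h | t.1.card < k + 1} J).Nonempty) ↔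
      J.card = k + 1 ∧ ∃ B, (J, B) ∈ vertexTiles (projLift a) h := by
  constructor
  · rintro ⟨t, ⟨ht, rfl⟩, b, hb, rfl, hne⟩
    have hcard := Finset.card_insert_of_notMem
      (Finset.disjoint_right.1 (disjoint_of_mem_vertexTiles ht) hb)
    rw [← hcard, linkRegion_vertexTiles_nonempty_iff hgen] at hne
    exact ⟨hcard, hne⟩
  · rintro ⟨hJ, B, hB⟩
    obtain ⟨t, ht, b, hb, hbt, rfl⟩ := hgen.exists_lower_vertexTile
      (u := LinearMap.proj (Fin.last d)) (fun i => by simp [projLift]) hB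
      (Finset.card_pos.1 (by lia))
    rw [Finset.card_insert_of_notMem hbt, Nat.succ_inj] at hJ
    refine ⟨t, ⟨ht, hJ⟩, b, hb, rfl, ?_⟩
    rw [← hJ, ← Finset.card_insert_of_notMem hbt, linkRegion_vertexTiles_nonempty_iff hgen]
    exact ⟨B, hB⟩

lemma constructionState_eq (hgen : IsGeneric (projLift a) h)
    (hspan : affineSpan ℝ (Set.range a) = ⊤)
    (hT : ∀ Q, (interior (hullOutside a Q)).Nonempty → T Q = delaunaySimplices a h Q) (k : ℕ) :
    constructionState a T k =
      ({I | I.card = k ∧ ∃ B, (I, B) ∈ vertexTiles (projLift a) h},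
        {t ∈ vertexTiles (projLift a) h | t.1.card < k}) := by
  induction k with
  | zero =>
    refine Prod.ext (Set.ext fun I => ?_) (by simp [constructionState])
    have hempty : I = ∅ → ∃ B, (I, B) ∈ vertexTiles (projLift a) h :=
      fun hI => hI ▸ exists_empty_mem_vertexTiles hgen hspan
    simpa [constructionState] using hempty
  | succ k ih =>
    have hunion : {t ∈ vertexTiles (projLift a) h | t.1.card < k} ∪
        {t ∈ vertexTiles (projLift a) h | t.1.card = k} =
        {t ∈ vertexTiles (projLift a) h | t.1.card < k + 1} := by
      ext t
      simp only [Set.mem_union, Set.mem_ofPred_eq, ← and_or_left, Nat.lt_succ_iff_lt_or_eq]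
    simp only [constructionState, ih, newTiles_vertexTiles hgen hT, hunion]
    exact Prod.ext (Set.ext (exists_insert_linkRegion_nonempty_iff hgen k)) rfl

lemma tilesAt_eq (hgen : IsGeneric (projLift a) h) (hspan : affineSpan ℝ (Set.range a) = ⊤)
    (hT : ∀ Q, (interior (hullOutside a Q)).Nonempty → T Q = delaunaySimplices a h Q) (k : ℕ) :
    tilesAt a T k = {t ∈ vertexTiles (projLift a) h | t.1.card = k} := by
  rw [tilesAt, indexFamily, tilesBefore, constructionState_eq hgen hspan hT,
    newTiles_vertexTiles hgen hT]

lemma constructedTiles_eq (hgen : IsGeneric (projLift a) h)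
    (hspan : affineSpan ℝ (Set.range a) = ⊤)
    (hT : ∀ Q, (interior (hullOutside a Q)).Nonempty → T Q = delaunaySimplices a h Q) :
    constructedTiles a T = vertexTiles (projLift a) h := by
  ext t
  simp only [constructedTiles, tilesAt_eq hgen hspan hT, Set.mem_iUnion₂]
  constructor
  · rintro ⟨k, -, ht, -⟩
    exact ht
  · exact fun ht => ⟨_, card_add_le_of_mem_vertexTiles hgen ht, ht, rfl⟩

lemma indexFamily_sub_eq_empty (hgen : IsGeneric (projLift a) h)
    (hspan : affineSpan ℝ (Set.range a) = ⊤)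
    (hT : ∀ Q, (interior (hullOutside a Q)).Nonempty → T Q = delaunaySimplices a h Q) :
    indexFamily a T (n - d) = ∅ := by
  rw [indexFamily, constructionState_eq hgen hspan hT, Set.eq_empty_iff_forall_notMem]
  rintro I ⟨hI, B, hB⟩
  have hcard : I.card + d + 1 ≤ n := card_add_le_of_mem_vertexTiles hgen hB
  lia

lemma construction_step_succeeds (hgen : IsGeneric (projLift a) h)
    (hspan : affineSpan ℝ (Set.range a) = ⊤)
    (hT : ∀ Q, (interior (hullOutside a Q)).Nonempty → T Q = delaunaySimplices a h Q) {k : ℕ}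
    {I : Finset (Fin n)} (hI : I ∈ indexFamily a T k) :
    (interior (hullOutside a I)).Nonempty ∧
      (linkRegion a (tilesBefore a T k) I).Nonempty ∧
      IsWeightedDelaunay a h I (linkRegion a (tilesBefore a T k) I)
        (linkSimplices a T (tilesBefore a T k) I) := by
  rw [indexFamily, constructionState_eq hgen hspan hT] at hI
  obtain ⟨rfl, B, hB⟩ := hI
  have hint := interior_hullOutside_nonempty (t := (I, B)) hB
  rw [tilesBefore, constructionState_eq hgen hspan hT, linkSimplices_vertexTiles hgen (hT I hint)]
  exact ⟨hint, (linkRegion_vertexTiles_nonempty_iff hgen).2 ⟨B, hB⟩, isWeightedDelaunay_of_subset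
    hgen (setOf_mem_vertexTiles_subset_delaunaySimplices I) (linkRegion_vertexTiles hgen I).symm⟩

end Construction

theorem theorem5 {d n : ℕ} (a : Fin n → Fin d → ℝ)
    (hspan : affineSpan ℝ (Set.range a) = ⊤)
    (h : Fin n → ℝ) (hgen : IsGenericHeight a h) :
    -- the weighted Delaunay triangulation of `ch_Q(A)` exists and is unique
    (∀ Q : Finset (Fin n), (interior (hullOutside a Q)).Nonempty →
      ∃! T : Set (Finset (Fin n)), IsWeightedDelaunay a h Q (hullOutside a Q) T) ∧
    -- the construction with these triangulations
    ∀ T : Finset (Fin n) → Set (Finset (Fin n)),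
      (∀ Q : Finset (Fin n), (interior (hullOutside a Q)).Nonempty →
        IsWeightedDelaunay a h Q (hullOutside a Q) (T Q)) →
      -- no step fails: every link region met is triangulated by the simplices of `T I` in it
      (∀ k : ℕ, k + d + 1 ≤ n → ∀ I ∈ indexFamily a T k,
        (interior (hullOutside a I)).Nonempty ∧
        (linkRegion a (tilesBefore a T k) I).Nonempty ∧
        IsWeightedDelaunay a h I (linkRegion a (tilesBefore a T k) I)
          (linkSimplices a T (tilesBefore a T k) I)) ∧
      -- the construction stops after step `n - d - 1`
      indexFamily a T (n - d) = ∅ ∧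
      -- the result is a regular fine zonotopal tiling, with the tiles of order `k` from step `k`
      IsFineZonotopalTiling a (constructedTiles a T) ∧
      (∀ k : ℕ, k + d + 1 ≤ n →
        tilesAt a T k = {t ∈ constructedTiles a T | t.1.card = k}) ∧
      IsRegularTiling a (constructedTiles a T) ∧
      -- it is the projection of the lower hull of the lifted zonotope
      constructedTiles a T = lowerHullLabels a h ∧
      tileSet (projLift a) '' constructedTiles a T =
        {G | ∃ F, IsLowerFacet (zonotope (fullLift a h)) F ∧ G = dropHeight '' F} := by
  have hg : IsGeneric (projLift a) h := hgen.isGeneric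
  have hspan' : Submodule.span ℝ (Set.range (projLift a)) = ⊤ := by
    rw [← Set.image_univ, ← Finset.coe_univ] at hspan ⊢
    exact affineSpan_image_eq_top_iff.1 hspan
  refine ⟨fun _ hQ => existsUnique_isWeightedDelaunay hg hQ, fun T hT => ?_⟩
  have hT' (Q) (hQ : (interior (hullOutside a Q)).Nonempty) : T Q = delaunaySimplices a h Q :=
    (hT Q hQ).eq_delaunaySimplices hg
  rw [constructedTiles_eq hg hspan hT']
  exact ⟨fun k _ I hI => construction_step_succeeds hg hspan hT' hI,
    indexFamily_sub_eq_empty hg hspan hT',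
    isFineZonotopalTiling_vertexTiles hg hspan',
    fun k _ => tilesAt_eq hg hspan hT' k,
    isRegularTiling_vertexTiles,
    (lowerHullLabels_eq hg).symm,
    image_tileSet_vertexTiles⟩
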